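/- **Theorem 4.3.** Let $G=\mathrm{Aff}_0(\mathbb R)=\{\begin{pmatrix}a&b\\0&1\end{pmatrix}: a>0,\ b\in\mathbb R\}$, with Lie algebra $\mathfrak g=\mathrm{aff}(\mathbb R)=\{\alpha X+\beta Y=\begin{pmatrix}\alpha&\beta\\0&0\end{pmatrix}\}$ and dual basis $X^*,Y^*$ of $\mathfrak g^*$. Let $\Omega_-\subset\mathfrak g^*$ be the co-adjoint orbit of $-Y^*$, with coordinates $(p,q)\in\mathbb R^2\mapsto pX^*-e^qY^*$. For $Z=\alpha X+\beta Y$ let $\tilde Z(F)=\langle F,Z\rangle$, so that $\tilde Z=\alpha p-\beta e^q$ in these coordinates. Let $$u\star v=\sum_{r\ge 0}\frac1{r!}\Big(\frac1{2i}\Big)^rP^r(u,v),\qquad P^r(u,v)=\sum\Lambda^{i_1j_1}\cdots\Lambda^{i_rj_r}\,\partial_{i_1\cdots i_r}u\,\partial_{j_1\cdots j_r}v,$$ be the Moyal product on $\mathbb R^2$, where $\Lambda^{pq}=1=-\Lambda^{qp}$, $\Lambda^{pp}=\Lambda^{qq}=0$. Let $\mathcal F_pv(x,q)=\frac1{\sqrt{2\pi}}\int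 e^{-ipx}v(p,q)\,dp$, let $\mathcal F_p^{-1}u(p,q)=\frac1{\sqrt{2\pi}}\int e^{ipx}u(x,q)\,dx$, and for $u\in C_c^\infty(\mathbb R^2)$ put $$\hat\ell_Z u=\mathcal F_p\big(i\tilde Z\star\mathcal F_p^{-1}u\big).$$ In the variables $y=-e^{q-x/2}<0$ and $t=q+x/2$ the operator $\hat\ell_Z$ acts in the variable $y$ only ($t$ is a parameter). It is regarded accordingly as an operator on $C_c^\infty((-\infty,0))\subset L^2\big((-\infty,0),\frac{dy}{|y|}\big)$, and $\exp(\hat\ell_Z)$ denotes the value at $\tau=1$ of the strongly continuous one-parameter unitary group $\exp(\tau\hat\ell_Z)$ generated by its closure. Then: 1. $\Omega_-$ is the open lower half-plane $\{F:\langle F,Y\rangle<0\}$, and $(p,q)\mapsto pX^*-e^qY^*$ is a bijection from $\mathbb R^2$ onto it. 2. $\exp:\mathfrak g\to G$ is bijective. 3. For all $Z\in\mathfrak g$ and $u\in C_c^\infty(\mathbb R^2)$ the series $i\tilde Z\star\mathcal F_p^{-1}u$ converges pointwise, its sum is integrable in $p$ for each $q$, and $\hat\ell_Zu\in C_c^\infty(\mathbb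 R^2)$. 4. The formula $$(T_{\Omega_-}(g)f)(y)=e^{iby}f(ay),\qquad g=\begin{pmatrix}a&b\\0&1\end{pmatrix}\in G,\quad f\in L^2\big((-\infty,0),\tfrac{dy}{|y|}\big),$$ defines a strongly continuous irreducible unitary representation of $G$. It is the representation associated with $\Omega_-$ by the orbit method: every $F\in\Omega_-$ has an admissible subalgebra $\mathfrak h$ (subordinate to $F$, of dimension $\frac12(\dim\mathfrak g+\dim\mathfrak g_F)$, where $\mathfrak g_F=\{V\in\mathfrak g:\langle F,[V,W]\rangle=0\ \forall W\in\mathfrak g\}$, and with $F+\mathfrak h^\perp$ contained in the orbit of $F$), and for every such $F$ and $\mathfrak h$, $T_{\Omega_-}$ is unitarily equivalent to $\mathrm{Ind}_H^G\chi_F$, where $H$ is the analytic subgroup with Lie algebra $\mathfrak h$ and $\chi_F(\exp V)=e^{i\langle F,V\rangle}$ for $V\in\mathfrak h$. 5. For every $Z\in\mathfrak g$, $\exp(\hat\ell_Z)$ exists, is uniquely determined, and equals $T_{\Omega_-}(\exp Z)$; that is, $(\exp(\hat\ell_Z)f)(y)=e^{iby}f(ay)$ with $\begin{pmatrix}a&b\\0&1\end{pmatrix}=\exp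 Z$. -/

import Mathlib

open MeasureTheory Filter Topology
open scoped ContDiff ENNReal

attribute [local instance] LieRing.ofAssociativeRing

noncomputable section

namespace AffPlane

/-! ### The group of orientation preserving affine maps of the line and its Lie algebra -/

/-- The connected component of the identity of the group of affine transformations of the line:
the matrices `(a b; 0 1)` with `a > 0`. -/
def Aff0 : Subgroup (GL (Fin 2) ℝ) where
  carrier := {g | 0 < g.val 0 0 ∧ g.val 1 0 = 0 ∧ g.val 1 1 = 1}
  mul_mem' := by
    rintro g h ⟨g1, g2, g3⟩ ⟨h1, h2, h3⟩
    simp only [Set.mem_ofPred_eq, Units.val_mul, Matrix.mul_apply, Fin.sum_univ_two]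
    rw [g2, g3, h2, h3]
    simpa using mul_pos g1 h1
  one_mem' := by simp
  inv_mem' := by
    rintro g ⟨g1, g2, g3⟩
    have hd : g.val.det = g.val 0 0 := by rw [Matrix.det_fin_two, g2, g3]; ring
    have hi : (g⁻¹).val = (g.val 0 0)⁻¹ • !![1, -g.val 0 1; 0, g.val 0 0] := by
      rw [Matrix.coe_units_inv, Matrix.inv_def, Matrix.adjugate_fin_two, hd, g2, g3,
        Ring.inverse_eq_inv', neg_zero]
    simp only [Set.mem_ofPred_eq]
    rw [hi]
    simp [g1, g1.ne']

/-- The coefficient `a` of `g = (a b; 0 1)`. -/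
def coeffA (g : Aff0) : ℝ := g.val.val 0 0

/-- The coefficient `b` of `g = (a b; 0 1)`. -/
def coeffB (g : Aff0) : ℝ := g.val.val 0 1

/-- The Lie algebra `aff(ℝ)`: the matrices `Z = (α β; 0 0)`, with the commutator bracket. -/
def aff : LieSubalgebra ℝ (Matrix (Fin 2) (Fin 2) ℝ) where
  carrier := {Z | Z 1 0 = 0 ∧ Z 1 1 = 0}
  add_mem' := by
    rintro Z W ⟨h1, h2⟩ ⟨h3, h4⟩
    simp [h1, h2, h3, h4]
  zero_mem' := by simp
  smul_mem' := by
    rintro c Z ⟨h1, h2⟩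
    simp [h1, h2]
  lie_mem' := by
    rintro Z W ⟨h1, h2⟩ ⟨h3, h4⟩
    simp [Ring.lie_def, Matrix.mul_apply, Fin.sum_univ_two, h1, h2, h3, h4]

/-- The generator `X = (1 0; 0 0)`. -/
def genX : aff := ⟨!![1, 0; 0, 0], by simp [aff]⟩

/-- The generator `Y = (0 1; 0 0)`; one has `[X, Y] = Y`. -/
def genY : aff := ⟨!![0, 1; 0, 0], by simp [aff]⟩

/-- The dual basis vector `X*`, which sends `(α β; 0 0)` to `α`. -/
def dualX : Module.Dual ℝ aff where
  toFun Z := Z.val 0 0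
  map_add' _ _ := rfl
  map_smul' _ _ := rfl

/-- The dual basis vector `Y*`, which sends `(α β; 0 0)` to `β`. -/
def dualY : Module.Dual ℝ aff where
  toFun Z := Z.val 0 1
  map_add' _ _ := rfl
  map_smul' _ _ := rfl

theorem exp_bottom_row (Z : aff) (j : Fin 2) :
    (NormedSpace.exp Z.val) 1 j = (1 : Matrix (Fin 2) (Fin 2) ℝ) 1 j := by
  let _ : NormedRing (Matrix (Fin 2) (Fin 2) ℝ) := Matrix.linftyOpNormedRing
  let _ : NormedAlgebra ℝ (Matrix (Fin 2) (Fin 2) ℝ) := Matrix.linftyOpNormedAlgebra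
  have h := NormedSpace.exp_series_hasSum_exp' (𝕂 := ℝ) Z.val
  have h1 : HasSum (fun n : ℕ => ((n.factorial : ℝ)⁻¹ • Z.val ^ n) 1 j)
      ((NormedSpace.exp Z.val) 1 j) :=
    h.map (Matrix.entryAddMonoidHom ℝ (1 : Fin 2) j) (continuous_id.matrix_elem 1 j)
  have hZ : ∀ k, Z.val 1 k = 0 := by
    intro k
    fin_cases k
    · exact Z.property.1
    · exact Z.property.2
  have h2 := hasSum_single (f := fun n : ℕ => ((n.factorial : ℝ)⁻¹ • Z.val ^ n) 1 j) 0 (by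
    intro n hn
    obtain ⟨m, rfl⟩ := Nat.exists_eq_succ_of_ne_zero hn
    simp [pow_succ', Matrix.mul_apply, hZ])
  rw [h1.unique h2]
  simp

/-- The exponential map `aff(ℝ) → Aff₀(ℝ)`, given by the matrix exponential. -/
def expG (Z : aff) : Aff0 :=
  ⟨(Matrix.isUnit_exp Z.val).unit, by
    have hu : IsUnit (NormedSpace.exp Z.val) := Matrix.isUnit_exp Z.val
    have h0 : (NormedSpace.exp Z.val) 1 0 = 0 := by rw [exp_bottom_row]; simp
    have h1 : (NormedSpace.exp Z.val) 1 1 = 1 := by rw [exp_bottom_row]; simp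
    refine ⟨?_, h0, h1⟩
    change 0 < (NormedSpace.exp Z.val) 0 0
    have hne : (NormedSpace.exp Z.val) 0 0 ≠ 0 := by
      have := (Matrix.isUnit_iff_isUnit_det _).1 hu
      rw [Matrix.det_fin_two, h0, h1] at this
      simpa using this
    let W : aff := (1 / 2 : ℝ) • Z
    have hW0 : (NormedSpace.exp W.val) 1 0 = 0 := by rw [exp_bottom_row]; simp
    have hs : NormedSpace.exp Z.val = NormedSpace.exp W.val * NormedSpace.exp W.val := by
      rw [← Matrix.exp_add_of_commute _ _ (Commute.refl _)]
      congr 1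
      change Z.val = (1 / 2 : ℝ) • Z.val + (1 / 2 : ℝ) • Z.val
      rw [← add_smul]
      norm_num
    have hq : (NormedSpace.exp Z.val) 0 0 = (NormedSpace.exp W.val) 0 0 ^ 2 := by
      rw [hs, Matrix.mul_apply, Fin.sum_univ_two, hW0]
      ring
    rw [hq] at hne ⊢
    positivity⟩

/-! ### Co-adjoint orbits -/

/-- The adjoint action `Ad(g) Z = g Z g⁻¹`. -/
def Ad (g : Aff0) (Z : aff) : aff :=
  ⟨g.val.val * Z.val * (g⁻¹).val.val, by
    have h : ∀ k, (g.val.val * Z.val) 1 k = 0 := by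
      intro k
      have hZ : Z.val 1 k = 0 := by
        fin_cases k
        · exact Z.property.1
        · exact Z.property.2
      rw [Matrix.mul_apply, Fin.sum_univ_two, g.property.2.1, hZ]
      ring
    constructor <;> simp [Matrix.mul_apply (M := g.val.val * Z.val), h]⟩

/-- The co-adjoint orbit of `F`: all functionals `K(g)F = F ∘ Ad(g⁻¹)`. -/
def coadjointOrbit (F : Module.Dual ℝ aff) : Set (Module.Dual ℝ aff) :=
  {F' | ∃ g : Aff0, ∀ Z, F' Z = F (Ad g⁻¹ Z)}

/-- The orbit `Ω₋`, the co-adjoint orbit of `-Y*`. -/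
def OmegaMinus : Set (Module.Dual ℝ aff) := coadjointOrbit (-dualY)

/-- The chart `(p, q) ↦ p X* - e^q Y*` of `Ω₋`. In it the Kirillov form is `dp ∧ dq`. -/
def chartMinus (x : ℝ × ℝ) : Module.Dual ℝ aff := x.1 • dualX - Real.exp x.2 • dualY

/-- The Hamiltonian function of `Z`, i.e. the linear function `F ↦ ⟨F, Z⟩` on `Ω₋`,
in the coordinates `(p, q)`. -/
def hamiltonian (Z : aff) (x : ℝ × ℝ) : ℂ := ((chartMinus x Z : ℝ) : ℂ)

/-! ### The Moyal product and the operators of deformation quantization -/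

/-- The partial derivatives on `ℝ²`: index `0` is `∂/∂p`, index `1` is `∂/∂q`. -/
def pderiv (i : Fin 2) (u : ℝ × ℝ → ℂ) (x : ℝ × ℝ) : ℂ :=
  if i = 0 then deriv (fun p => u (p, x.2)) x.1 else deriv (fun q => u (x.1, q)) x.2

/-- The iterated partial derivative `∂_{i₁ ⋯ i_r}`. -/
def iterPderiv {r : ℕ} (I : Fin r → Fin 2) (u : ℝ × ℝ → ℂ) : ℝ × ℝ → ℂ :=
  (List.ofFn I).foldr pderiv u

/-- The Poisson tensor of `dp ∧ dq`, normalized by `{u, v} = ∂_p u ∂_q v - ∂_q u ∂_p v`. -/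
def poissonTensor : Matrix (Fin 2) (Fin 2) ℂ := !![0, 1; -1, 0]

/-- The bidifferential operator
`P^r(u, v) = Λ^{i₁ j₁} ⋯ Λ^{i_r j_r} ∂_{i₁ ⋯ i_r} u ∂_{j₁ ⋯ j_r} v` (summation convention). -/
def moyalP (r : ℕ) (u v : ℝ × ℝ → ℂ) (x : ℝ × ℝ) : ℂ :=
  ∑ I : Fin r → Fin 2, ∑ J : Fin r → Fin 2,
    (∏ k, poissonTensor (I k) (J k)) * iterPderiv I u x * iterPderiv J v x

/-- The `r`-th term of the Moyal product; the term `r = 0` is `u v`. -/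
def moyalTerm (r : ℕ) (u v : ℝ × ℝ → ℂ) (x : ℝ × ℝ) : ℂ :=
  1 / (r.factorial : ℂ) * (1 / (2 * Complex.I)) ^ r * moyalP r u v x

/-- The Moyal product `u ⋆ v = ∑_r (1/r!) (1/(2i))^r P^r(u, v)`. -/
def moyal (u v : ℝ × ℝ → ℂ) (x : ℝ × ℝ) : ℂ := ∑' r : ℕ, moyalTerm r u v x

/-- The function `i Z̃`, where `Z̃` is the Hamiltonian function of `Z`. -/
def iHam (Z : aff) (x : ℝ × ℝ) : ℂ := Complex.I * hamiltonian Z x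

/-- Left Moyal multiplication by `i Z̃`. -/
def ell (Z : aff) (v : ℝ × ℝ → ℂ) : ℝ × ℝ → ℂ := moyal (iHam Z) v

/-- The partial Fourier transform from the variable `p` to the variable `x`. -/
def fourierP (v : ℝ × ℝ → ℂ) (w : ℝ × ℝ) : ℂ :=
  1 / (Real.sqrt (2 * Real.pi) : ℂ) *
    ∫ p : ℝ, Complex.exp (-(Complex.I * p * w.1)) * v (p, w.2)

/-- The inverse partial Fourier transform from the variable `x` to the variable `p`. -/
def fourierPInv (u : ℝ × ℝ → ℂ) (w : ℝ × ℝ) : ℂ :=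
  1 / (Real.sqrt (2 * Real.pi) : ℂ) *
    ∫ x : ℝ, Complex.exp (Complex.I * w.1 * x) * u (x, w.2)

/-- The operator `ℓ̂_Z = F_p ∘ ℓ_Z ∘ F_p⁻¹` on functions of `(x, q)`. -/
def ellHat (Z : aff) (u : ℝ × ℝ → ℂ) : ℝ × ℝ → ℂ := fourierP (ell Z (fourierPInv u))

/-- Compactly supported smooth functions on the plane. -/
def IsTest (u : ℝ × ℝ → ℂ) : Prop := ContDiff ℝ ∞ u ∧ HasCompactSupport u

/-- With `s = q - x/2`, `t = q + x/2` and `y = -e^s`, the function `y ↦ u(x, q)` on the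
half-line `y < 0`, for a fixed value of `t`. (The values at `y ≥ 0` are irrelevant.) -/
def slice (u : ℝ × ℝ → ℂ) (t y : ℝ) : ℂ :=
  u (t - Real.log (-y), (Real.log (-y) + t) / 2)

/-! ### The Hilbert space, unitary representations and exponentials -/

/-- The measure `dy/|y|` on the half-line `y < 0`. -/
def muMinus : Measure ℝ :=
  (volume.restrict (Set.Iio 0)).withDensity (fun y => ENNReal.ofReal (1 / |y|))

/-- The Hilbert space `L²((-∞, 0), dy/|y|)`. -/
abbrev HMinus : Type := Lp ℂ 2 muMinus

/-- Strongly continuous unitary representations of `G` on `E`. -/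
structure UnitaryRep (G : Type*) [Group G] [TopologicalSpace G]
    (E : Type*) [NormedAddCommGroup E] [InnerProductSpace ℂ E] where
  /-- the action -/
  act : G →* (E ≃ₗᵢ[ℂ] E)
  /-- strong continuity -/
  continuous_act : ∀ f : E, Continuous fun g => act g f

section Reps

variable {G : Type*} [Group G] [TopologicalSpace G]
  {E : Type*} [NormedAddCommGroup E] [InnerProductSpace ℂ E]

/-- Topological irreducibility: there are exactly two closed invariant subspaces. -/
def UnitaryRep.IsIrreducible (T : UnitaryRep G E) : Prop :=
  Nontrivial E ∧ ∀ W : Submodule ℂ E, IsClosed (W : Set E) →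
    (∀ g, ∀ f ∈ W, T.act g f ∈ W) → W = ⊥ ∨ W = ⊤

/-- The graph of the infinitesimal generator of a one-parameter unitary group. -/
def generatorGraph (U : UnitaryRep (Multiplicative ℝ) E) : Set (E × E) :=
  {z | HasDerivAt (fun t : ℝ => U.act (Multiplicative.ofAdd t) z.1) z.2 0}

/-- `V = exp(A)` for the operator `A` with graph `Γ`: the closure of `A` generates a strongly
continuous one-parameter unitary group `t ↦ exp(tA)`, and `V` is its value at `t = 1`. -/
def IsExpOf (Γ : Set (E × E)) (V : E ≃ₗᵢ[ℂ] E) : Prop :=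
  ∃ U : UnitaryRep (Multiplicative ℝ) E,
    generatorGraph U = closure Γ ∧ U.act (Multiplicative.ofAdd 1) = V

/-! ### Induced representations -/

/-- The continuous functions `Φ` on `G` with `Φ(xh) = χ(h)⁻¹ Φ(x)` for `h ∈ H` that have compact
support modulo `H`. -/
def inducedSections (H : Subgroup G) (χ : H →* Circle) : Submodule ℂ (G → ℂ) where
  carrier := {Φ | Continuous Φ ∧ (∀ x : G, ∀ h : H, Φ (x * h) = ((χ h)⁻¹ : Circle) * Φ x) ∧
    ∃ K : Set (G ⧸ H), IsCompact K ∧ ∀ x : G, (x : G ⧸ H) ∉ K → Φ x = 0}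
  add_mem' := by
    rintro Φ Ψ ⟨h1, h2, K, hK, h3⟩ ⟨k1, k2, L, hL, k3⟩
    refine ⟨h1.add k1, fun x h => ?_, K ∪ L, hK.union hL, fun x hx => ?_⟩
    · simp only [Pi.add_apply, h2, k2]; ring
    · simp only [Set.mem_union, not_or] at hx
      simp [h3 x hx.1, k3 x hx.2]
  zero_mem' := ⟨continuous_const, fun x h => by simp, ∅, isCompact_empty, fun x _ => rfl⟩
  smul_mem' := by
    rintro c Φ ⟨h1, h2, K, hK, h3⟩
    refine ⟨h1.const_smul c, fun x h => ?_, K, hK, fun x hx => ?_⟩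
    · simp only [Pi.smul_apply, h2, smul_eq_mul]; ring
    · simp [h3 x hx]

/-- `T` is unitarily equivalent to the induced representation `Ind_H^G χ`, for a closed subgroup
`H` for which `G ⧸ H` carries a nonzero `G`-invariant Radon measure `m`. The induced representation
acts by left translation on the completion of `inducedSections H χ` for the norm
`‖Φ‖² = ∫_{G ⧸ H} |Φ|² dm`, so `T` is equivalent to it if and only if the sections embed
isometrically and equivariantly onto a dense subspace. (`x ↦ Φ(x⁻¹)` gives the realization by right
translations, on the functions `Ψ` with `Ψ(hx) = χ(h) Ψ(x)`.) -/
def IsInduced (H : Subgroup G) (χ : H →* Circle) (T : UnitaryRep G E) : Prop :=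
  letI : MeasurableSpace (G ⧸ H) := borel (G ⧸ H)
  IsClosed (H : Set G) ∧ Continuous χ ∧
  ∃ m : Measure (G ⧸ H), m ≠ 0 ∧ m.Regular ∧
    (∀ g : G, m.map (fun z => g • z) = m) ∧
    ∃ J : inducedSections H χ →ₗ[ℂ] E,
      (∀ Φ, ‖J Φ‖ₑ ^ 2 = ∫⁻ z, ‖Φ.val z.out‖ₑ ^ 2 ∂m) ∧
      DenseRange J ∧
      ∀ g : G, ∀ Φ Ψ : inducedSections H χ,
        (∀ x, Ψ.val x = Φ.val (g⁻¹ * x)) → J Ψ = T.act g (J Φ)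

end Reps

/-! ### The orbit method -/

/-- `𝔥` is an admissible subalgebra (a real polarization satisfying the Pukanszky condition)
for `F`: it is subordinate to `F`, it has the maximal possible dimension
`(dim 𝔤 + dim 𝔤_F) / 2`, and `F + 𝔥^⊥` lies in the orbit of `F`. -/
structure IsAdmissible (F : Module.Dual ℝ aff) (𝔥 : LieSubalgebra ℝ aff) : Prop where
  subordinate : ∀ V ∈ 𝔥, ∀ W ∈ 𝔥, F ⁅V, W⁆ = 0
  maximal : ∀ 𝔤F : Submodule ℝ aff, (∀ V, V ∈ 𝔤F ↔ ∀ W, F ⁅V, W⁆ = 0) →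
    2 * Module.finrank ℝ 𝔥 = Module.finrank ℝ aff + Module.finrank ℝ 𝔤F
  pukanszky : ∀ F' : Module.Dual ℝ aff, (∀ V ∈ 𝔥, F' V = 0) → F + F' ∈ coadjointOrbit F

/-- The analytic subgroup with Lie algebra `𝔥`: the subgroup generated by `exp 𝔥`. -/
def analyticSubgroup (𝔥 : LieSubalgebra ℝ aff) : Subgroup Aff0 :=
  Subgroup.closure (expG '' (𝔥 : Set aff))

/-- `T` is unitarily equivalent to `Ind_H^G χ_F`, where `H` is the analytic subgroup of `𝔥` and
`χ_F` is its unitary character with `χ_F(exp V) = e^{i⟨F, V⟩}` for `V ∈ 𝔥`. -/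
def IsOrbitInduced {E : Type*} [NormedAddCommGroup E] [InnerProductSpace ℂ E]
    (F : Module.Dual ℝ aff) (𝔥 : LieSubalgebra ℝ aff) (T : UnitaryRep Aff0 E) : Prop :=
  ∃ χ : analyticSubgroup 𝔥 →* Circle,
    (∀ V : aff, ∀ hV : V ∈ 𝔥,
      χ ⟨expG V, Subgroup.subset_closure (Set.mem_image_of_mem expG hV)⟩ = Circle.exp (F V)) ∧
    IsInduced (analyticSubgroup 𝔥) χ T

/-- `T` is the unitary representation associated by the orbit method to the co-adjoint orbit `Ω`:
each point of `Ω` has an admissible subalgebra, and `T` is the representation induced from any of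
these at any point. -/
def IsOrbitMethodRep {E : Type*} [NormedAddCommGroup E] [InnerProductSpace ℂ E]
    (Ω : Set (Module.Dual ℝ aff)) (T : UnitaryRep Aff0 E) : Prop :=
  ∀ F ∈ Ω, (∃ 𝔥, IsAdmissible F 𝔥) ∧ ∀ 𝔥, IsAdmissible F 𝔥 → IsOrbitInduced F 𝔥 T

/-- The graph, in `L²((-∞, 0), dy/|y|)`, of the operator `ℓ̂_Z` on functions of the variable
`y = -e^{q - x/2}`, the variable `t = q + x/2` being a parameter. -/
def ellHatGraph (Z : aff) : Set (HMinus × HMinus) :=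
  {z | ∃ u : ℝ × ℝ → ℂ, IsTest u ∧ ∃ t : ℝ,
    (z.1 : ℝ → ℂ) =ᵐ[muMinus] slice u t ∧ (z.2 : ℝ → ℂ) =ᵐ[muMinus] slice (ellHat Z u) t}

end AffPlane

end

open AffPlane

/-!
The logarithmic coordinate `s = log (-y)` identifies `L²((-∞, 0), dy/|y|)` with `L²(ℝ, ds)`
(`map_negExp`). In it `T(g)` is the translation by `log a` followed by the multiplication by
`e^{-i b e^s}`.

*The operators.* All partial derivatives of order at least two of `i Z̃` vanish, except those with
respect to `q` alone, which are all equal. Hence, up to two extra terms, `i Z̃ ⋆ F_p⁻¹ u` is the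
series of the `F_p⁻¹ ((-x/2)^r / r! · u)`, which sums to `F_p⁻¹ (e^{-x/2} u)`
(`IsTest.hasSum_moyalTerm`). Fourier inversion gives
`ℓ̂_Z = α (½ ∂_q - ∂_x) - i β e^{q - x/2}` (`IsTest.ellHat_eq`), that is `α ∂_s - i β e^s`, and the
slices of test functions on the plane are exactly the test functions of `s` (`ellHatGraph_eq`).

*Exponentials.* On the test functions of `s`, the generator of `τ ↦ T(exp τZ)` is this operator
(`mem_generatorGraph_oneParam`). They form a dense subspace invariant under the group, hence a core
(`closure_eq_generatorGraph`). The generator determines the group, because it is skew-symmetric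
(`flow_eq_of_generatorGraph_eq`).

*Irreducibility.* If `h` is orthogonal to all `T(g)f`, then the Fourier transform of
`f(ay) conj(h(y)) dy/|y|` vanishes for each `a > 0`, so that `f(ay) h(y) = 0` almost everywhere.
Integration over `a` gives `f = 0` or `h = 0` (`repMinus_orthogonal`).

*Orbit method.* By the Pukanszky condition the only admissible subalgebra at a point `F` of the
lower half-plane is `ℝ Y` (`mem_iff_of_isAdmissible`). A section `Φ` of the representation induced
from `exp ℝ Y` is determined by its values on the diagonal elements, and `y ↦ Φ(F(Y)/y 0; 0 1)`
is the intertwining map (`isInduced_repMinus`).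
-/

namespace AffPlane

/-! ### The group, its Lie algebra and the exponential map in coordinates -/

theorem coeffA_pos (g : Aff0) : 0 < coeffA g := g.property.1

theorem Aff0.ext {g h : Aff0} (ha : coeffA g = coeffA h) (hb : coeffB g = coeffB h) : g = h := by
  apply Subtype.ext
  apply Units.ext
  ext i j
  fin_cases i <;> fin_cases j
  · exact ha
  · exact hb
  · exact g.property.2.1.trans h.property.2.1.symm
  · exact g.property.2.2.trans h.property.2.2.symm

@[simp] theorem coeffA_one : coeffA 1 = 1 := by simp [coeffA]

@[simp] theorem coeffB_one : coeffB 1 = 0 := by simp [coeffB]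

@[simp] theorem coeffA_mul (g h : Aff0) : coeffA (g * h) = coeffA g * coeffA h := by
  have h1 : h.val.val 1 0 = 0 := h.property.2.1
  simp [coeffA, Matrix.mul_apply, Fin.sum_univ_two, h1]

@[simp] theorem coeffB_mul (g h : Aff0) :
    coeffB (g * h) = coeffA g * coeffB h + coeffB g := by
  have h1 : h.val.val 1 1 = 1 := h.property.2.2
  simp [coeffA, coeffB, Matrix.mul_apply, Fin.sum_univ_two, h1]

@[simp] theorem coeffA_inv (g : Aff0) : coeffA g⁻¹ = (coeffA g)⁻¹ := by
  have h := coeffA_mul g⁻¹ g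
  rw [inv_mul_cancel, coeffA_one] at h
  exact eq_inv_of_mul_eq_one_left h.symm

@[simp] theorem coeffB_inv (g : Aff0) : coeffB g⁻¹ = -(coeffB g / coeffA g) := by
  have h := coeffB_mul g⁻¹ g
  rw [inv_mul_cancel, coeffB_one, coeffA_inv] at h
  rw [div_eq_inv_mul]
  linarith

/-- The element `(a b; 0 1)` of the group, for `a > 0`. -/
noncomputable def affMk (a b : ℝ) (ha : 0 < a) : Aff0 :=
  ⟨⟨!![a, b; 0, 1], !![a⁻¹, -(a⁻¹ * b); 0, 1],
    by ext i j; fin_cases i <;> fin_cases j <;> simp [Matrix.mul_apply, ha.ne'],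
    by ext i j; fin_cases i <;> fin_cases j <;> simp [Matrix.mul_apply, ha.ne']⟩,
    by simpa using ha, by simp, by simp⟩

@[simp] theorem coeffA_affMk (a b : ℝ) (ha : 0 < a) : coeffA (affMk a b ha) = a := rfl

@[simp] theorem coeffB_affMk (a b : ℝ) (ha : 0 < a) : coeffB (affMk a b ha) = b := rfl

theorem continuous_coeffA : Continuous coeffA :=
  (Units.continuous_val.comp continuous_subtype_val).matrix_elem 0 0

theorem continuous_coeffB : Continuous coeffB :=
  (Units.continuous_val.comp continuous_subtype_val).matrix_elem 0 1

/-- The topology of the group is that of the half-plane of the coefficients `(a, b)`. -/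
theorem continuous_aff0 {S : Type*} [TopologicalSpace S] {f : S → Aff0}
    (ha : Continuous fun s => coeffA (f s)) (hb : Continuous fun s => coeffB (f s)) :
    Continuous f := by
  have key : ∀ k : S → Aff0, (Continuous fun s => coeffA (k s)) →
      (Continuous fun s => coeffB (k s)) → Continuous fun s => (k s).val.val := by
    intro k ka kb
    refine continuous_matrix fun i j => ?_
    fin_cases i <;> fin_cases j
    · exact ka
    · exact kb
    · exact (continuous_const (y := (0 : ℝ))).congr fun s => (k s).property.2.1.symm
    · exact (continuous_const (y := (1 : ℝ))).congr fun s => (k s).property.2.2.symm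
  refine Continuous.subtype_mk (f := fun s => (f s).val) ?_ _
  refine Units.continuous_iff.2 ⟨key f ha hb, key (fun s => (f s)⁻¹) ?_ ?_⟩
  · simp only [coeffA_inv]
    exact ha.inv₀ fun s => (coeffA_pos _).ne'
  · simp only [coeffB_inv]
    exact (hb.div ha fun s => (coeffA_pos _).ne').neg

theorem aff_ext {Z W : aff} (h0 : Z.val 0 0 = W.val 0 0) (h1 : Z.val 0 1 = W.val 0 1) :
    Z = W := by
  apply Subtype.ext
  ext i j
  fin_cases i <;> fin_cases j
  · exact h0
  · exact h1
  · exact Z.property.1.trans W.property.1.symm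
  · exact Z.property.2.trans W.property.2.symm

theorem aff_eq_smul_add (Z : aff) : Z = Z.val 0 0 • genX + Z.val 0 1 • genY := by
  apply aff_ext <;> simp [genX, genY]

theorem dual_apply (F : Module.Dual ℝ aff) (Z : aff) :
    F Z = Z.val 0 0 * F genX + Z.val 0 1 * F genY := by
  conv_lhs => rw [aff_eq_smul_add Z]
  simp

theorem dual_ext {F F' : Module.Dual ℝ aff} (hX : F genX = F' genX) (hY : F genY = F' genY) :
    F = F' :=
  LinearMap.ext fun Z => by rw [dual_apply, dual_apply F', hX, hY]

@[simp] theorem genX_zero_zero : genX.val 0 0 = 1 := rfl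
@[simp] theorem genX_zero_one : genX.val 0 1 = 0 := rfl
@[simp] theorem genY_zero_zero : genY.val 0 0 = 0 := rfl
@[simp] theorem genY_zero_one : genY.val 0 1 = 1 := rfl

theorem dualX_apply (Z : aff) : dualX Z = Z.val 0 0 := rfl
theorem dualY_apply (Z : aff) : dualY Z = Z.val 0 1 := rfl

theorem coeffA_expG (Z : aff) : coeffA (expG Z) = Real.exp (Z.val 0 0) := by
  let _ : NormedRing (Matrix (Fin 2) (Fin 2) ℝ) := Matrix.linftyOpNormedRing
  let _ : NormedAlgebra ℝ (Matrix (Fin 2) (Fin 2) ℝ) := Matrix.linftyOpNormedAlgebra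
  have h := NormedSpace.exp_series_hasSum_exp' (𝕂 := ℝ) Z.val
  have h1 : HasSum (fun n : ℕ => ((n.factorial : ℝ)⁻¹ • Z.val ^ n) 0 0)
      ((NormedSpace.exp Z.val) 0 0) :=
    h.map (Matrix.entryAddMonoidHom ℝ (0 : Fin 2) 0) (continuous_id.matrix_elem 0 0)
  have hp : ∀ n : ℕ, (Z.val ^ n) 0 0 = Z.val 0 0 ^ n := by
    intro n
    induction n with
    | zero => simp
    | succ n ih =>
      rw [pow_succ, Matrix.mul_apply, Fin.sum_univ_two, ih, Z.property.1, pow_succ]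
      ring
  have h2 := NormedSpace.exp_series_hasSum_exp' (𝕂 := ℝ) (Z.val 0 0)
  rw [Real.exp_eq_exp_ℝ]
  refine h1.unique ?_
  simpa only [Matrix.smul_apply, hp] using h2

theorem mul_coeffB_expG (Z : aff) :
    Z.val 0 0 * coeffB (expG Z) = Z.val 0 1 * (Real.exp (Z.val 0 0) - 1) := by
  let _ : NormedRing (Matrix (Fin 2) (Fin 2) ℝ) := Matrix.linftyOpNormedRing
  let _ : NormedAlgebra ℝ (Matrix (Fin 2) (Fin 2) ℝ) := Matrix.linftyOpNormedAlgebra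
  let _ : NormedAlgebra ℚ (Matrix (Fin 2) (Fin 2) ℝ) := NormedAlgebra.restrictScalars ℚ ℝ _
  -- compare the upper right entries of `Z * exp Z = exp Z * Z`
  have hc : Z.val * NormedSpace.exp Z.val = NormedSpace.exp Z.val * Z.val :=
    (Commute.refl Z.val).exp_right
  have h := congrFun (congrFun hc 0) 1
  rw [Matrix.mul_apply, Matrix.mul_apply, Fin.sum_univ_two, Fin.sum_univ_two, exp_bottom_row,
    Z.property.2, Matrix.one_apply_eq] at h
  have hA : (NormedSpace.exp Z.val) 0 0 = Real.exp (Z.val 0 0) := coeffA_expG Z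
  rw [hA] at h
  change Z.val 0 0 * (NormedSpace.exp Z.val) 0 1 = _
  linarith

theorem coeffB_expG_of_eq_zero (Z : aff) (hZ : Z.val 0 0 = 0) :
    coeffB (expG Z) = Z.val 0 1 := by
  let _ : NormedRing (Matrix (Fin 2) (Fin 2) ℝ) := Matrix.linftyOpNormedRing
  let _ : NormedAlgebra ℝ (Matrix (Fin 2) (Fin 2) ℝ) := Matrix.linftyOpNormedAlgebra
  have h := NormedSpace.exp_series_hasSum_exp' (𝕂 := ℝ) Z.val
  have h1 : HasSum (fun n : ℕ => ((n.factorial : ℝ)⁻¹ • Z.val ^ n) 0 1)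
      ((NormedSpace.exp Z.val) 0 1) :=
    h.map (Matrix.entryAddMonoidHom ℝ (0 : Fin 2) 1) (continuous_id.matrix_elem 0 1)
  have hsq : Z.val ^ 2 = 0 := by
    have h10 := Z.property.1
    have h11 := Z.property.2
    ext i j
    fin_cases i <;> fin_cases j <;> simp [sq, Matrix.mul_apply, hZ, h10, h11]
  have h2 := hasSum_single (f := fun n : ℕ => ((n.factorial : ℝ)⁻¹ • Z.val ^ n) 0 1) 1 (by
    intro n hn
    rcases n with _ | _ | n
    · simp
    · exact absurd rfl hn
    · have hz : Z.val ^ (n + 2) = 0 := by rw [pow_add, hsq, mul_zero]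
      simp [hz])
  refine (h1.unique h2).trans ?_
  simp

theorem expG_bijective : Function.Bijective expG := by
  constructor
  · intro Z W h
    have hA := congrArg coeffA h
    rw [coeffA_expG, coeffA_expG] at hA
    have h0 := Real.exp_injective hA
    have hB := congrArg coeffB h
    refine aff_ext h0 ?_
    by_cases hz : Z.val 0 0 = 0
    · rw [coeffB_expG_of_eq_zero Z hz, coeffB_expG_of_eq_zero W (h0 ▸ hz)] at hB
      exact hB
    · have hne : Real.exp (Z.val 0 0) - 1 ≠ 0 := by
        rw [sub_ne_zero, Ne, Real.exp_eq_one_iff]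
        exact hz
      have h1 := mul_coeffB_expG Z
      rw [hB, h0, mul_coeffB_expG W] at h1
      rw [h0] at hne
      exact (mul_right_cancel₀ hne h1).symm
  · intro g
    have ha := coeffA_pos g
    by_cases h1 : coeffA g = 1
    · refine ⟨coeffB g • genY, Aff0.ext ?_ ?_⟩
      · rw [coeffA_expG, h1]; simp
      · rw [coeffB_expG_of_eq_zero] <;> simp
    · have hl : Real.log (coeffA g) ≠ 0 := by
        intro h
        exact h1 (Real.eq_one_of_pos_of_log_eq_zero ha h)
      have hne : coeffA g - 1 ≠ 0 := sub_ne_zero.2 h1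
      let Z : aff := Real.log (coeffA g) • genX +
        (Real.log (coeffA g) * coeffB g / (coeffA g - 1)) • genY
      have hZ0 : Z.val 0 0 = Real.log (coeffA g) := by simp [Z]
      have hZ1 : Z.val 0 1 = Real.log (coeffA g) * coeffB g / (coeffA g - 1) := by simp [Z]
      refine ⟨Z, Aff0.ext ?_ ?_⟩
      · rw [coeffA_expG, hZ0, Real.exp_log ha]
      · have h := mul_coeffB_expG Z
        rw [hZ0, hZ1, Real.exp_log ha, div_mul_cancel₀ _ hne] at h
        exact mul_left_cancel₀ hl h

theorem expG_add_of_commute {Z W : aff} (h : Commute Z.val W.val) :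
    expG (Z + W) = expG Z * expG W :=
  Subtype.ext (Units.ext (Matrix.exp_add_of_commute Z.val W.val h))

theorem expG_add_smul (Z : aff) (s t : ℝ) :
    expG ((s + t) • Z) = expG (s • Z) * expG (t • Z) := by
  rw [add_smul]
  exact expG_add_of_commute ((Commute.refl Z.val).smul_left s |>.smul_right t)

theorem expG_zero : expG 0 = 1 := by
  apply Aff0.ext
  · rw [coeffA_expG]; simp
  · rw [coeffB_expG_of_eq_zero] <;> simp

theorem coeffA_expG_smul (Z : aff) (t : ℝ) :
    coeffA (expG (t • Z)) = Real.exp (Z.val 0 0 * t) := by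
  rw [coeffA_expG]; simp [mul_comm]

theorem hasDerivAt_coeffB_expG_smul (Z : aff) (t : ℝ) :
    HasDerivAt (fun t : ℝ => coeffB (expG (t • Z))) (Z.val 0 1 * Real.exp (Z.val 0 0 * t)) t := by
  by_cases hz : Z.val 0 0 = 0
  · have h : (fun t : ℝ => coeffB (expG (t • Z))) = fun t => t * Z.val 0 1 := by
      funext t
      rw [coeffB_expG_of_eq_zero] <;> simp [hz]
    rw [h, hz]
    simpa using (hasDerivAt_id t).mul_const (Z.val 0 1)
  · have h : (fun t : ℝ => coeffB (expG (t • Z))) =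
        fun t => Z.val 0 1 / Z.val 0 0 * (Real.exp (Z.val 0 0 * t) - 1) := by
      funext t
      rcases eq_or_ne t 0 with rfl | ht
      · simp [expG_zero]
      · have h := mul_coeffB_expG (t • Z)
        have e0 : (t • Z).val 0 0 = Z.val 0 0 * t := by simp [mul_comm]
        have e1 : (t • Z).val 0 1 = t * Z.val 0 1 := by simp
        rw [e0, e1] at h
        field_simp
        apply mul_left_cancel₀ ht
        linarith
    rw [h]
    have := ((((hasDerivAt_id t).const_mul (Z.val 0 0)).exp).sub_const 1).const_mul
      (Z.val 0 1 / Z.val 0 0)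
    refine this.congr_deriv ?_
    simp only [id, mul_one]
    field_simp

/-! ### Co-adjoint orbits and admissible subalgebras -/

theorem Ad_zero_zero (g : Aff0) (Z : aff) : (Ad g Z).val 0 0 = Z.val 0 0 := by
  have hZ0 := Z.property.1
  have hZ1 := Z.property.2
  have hi := coeffA_inv g
  have hi' : (g⁻¹).val.val 1 0 = 0 := (g⁻¹).property.2.1
  simp only [coeffA] at hi
  have hA := (coeffA_pos g).ne'
  simp only [coeffA] at hA
  simp only [Ad, Matrix.mul_apply, Fin.sum_univ_two, hZ0, hZ1, hi, hi']
  field_simp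
  ring

theorem Ad_zero_one (g : Aff0) (Z : aff) :
    (Ad g Z).val 0 1 = coeffA g * Z.val 0 1 - coeffB g * Z.val 0 0 := by
  have hZ0 := Z.property.1
  have hZ1 := Z.property.2
  have hb := coeffB_inv g
  have hi' : (g⁻¹).val.val 1 1 = 1 := (g⁻¹).property.2.2
  have hA := (coeffA_pos g).ne'
  simp only [coeffA, coeffB] at hb hA ⊢
  simp only [Ad, Matrix.mul_apply, Fin.sum_univ_two, hZ0, hZ1, hb, hi']
  field_simp
  ring

/-- The orbit of a point of the open lower half-plane is the open lower half-plane. -/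
theorem coadjointOrbit_of_neg {F : Module.Dual ℝ aff} (hF : F genY < 0) :
    coadjointOrbit F = {F' | F' genY < 0} := by
  ext F'
  constructor
  · rintro ⟨g, hg⟩
    change F' genY < 0
    rw [hg, dual_apply, Ad_zero_zero, Ad_zero_one]
    simp only [genY_zero_zero, genY_zero_one, zero_mul, mul_one, mul_zero, sub_zero, zero_add]
    exact mul_neg_of_pos_of_neg (coeffA_pos _) hF
  · intro hF'
    have hF' : F' genY < 0 := hF'
    -- `g⁻¹` has the coefficients `a = F'(Y) / F(Y)` and `b = (F(X) - F'(X)) / F(Y)`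
    refine ⟨(affMk (F' genY / F genY) ((F genX - F' genX) / F genY)
      (div_pos_of_neg_of_neg hF' hF))⁻¹, fun Z => ?_⟩
    rw [inv_inv, dual_apply F (Ad _ _), Ad_zero_zero, Ad_zero_one, coeffA_affMk, coeffB_affMk,
      dual_apply F']
    field_simp [hF.ne]
    ring

theorem OmegaMinus_eq : OmegaMinus = {F | F genY < 0} :=
  coadjointOrbit_of_neg (by simp [dualY_apply])

theorem chartMinus_apply (x : ℝ × ℝ) (Z : aff) :
    chartMinus x Z = x.1 * Z.val 0 0 - Real.exp x.2 * Z.val 0 1 := by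
  simp [chartMinus, dualX_apply, dualY_apply]

theorem bijOn_chartMinus : Set.BijOn chartMinus Set.univ OmegaMinus := by
  rw [OmegaMinus_eq]
  refine ⟨fun x _ => ?_, fun x _ y _ h => ?_, fun F hF => ?_⟩
  · simp [chartMinus_apply, Real.exp_pos]
  · have hX := congrArg (fun F : Module.Dual ℝ aff => F genX) h
    have hY := congrArg (fun F : Module.Dual ℝ aff => F genY) h
    simp only [chartMinus_apply, genX_zero_zero, genX_zero_one, genY_zero_zero, genY_zero_one,
      mul_one, mul_zero, sub_zero, zero_sub, neg_inj, Real.exp_eq_exp] at hX hY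
    exact Prod.ext hX hY
  · have hF : F genY < 0 := hF
    refine ⟨(F genX, Real.log (-F genY)), trivial, dual_ext ?_ ?_⟩
    · simp [chartMinus_apply]
    · simp [chartMinus_apply, Real.exp_log_of_neg hF]

/-- The subalgebra `ℝ Y`. -/
def lineY : LieSubalgebra ℝ aff where
  carrier := {V | V.val 0 0 = 0}
  add_mem' := by
    intro V W hV hW
    have hV : V.val 0 0 = 0 := hV
    have hW : W.val 0 0 = 0 := hW
    change V.val 0 0 + W.val 0 0 = 0
    rw [hV, hW, add_zero]
  zero_mem' := rfl
  smul_mem' := by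
    intro c V hV
    have hV : V.val 0 0 = 0 := hV
    change c * V.val 0 0 = 0
    rw [hV, mul_zero]
  lie_mem' := by
    intro V W hV hW
    have hV : V.val 0 0 = 0 := hV
    have hW : W.val 0 0 = 0 := hW
    have h1 := V.property.1
    have h2 := W.property.1
    change (V.val * W.val - W.val * V.val) 0 0 = 0
    simp [Matrix.mul_apply, hV, hW, h1, h2]

theorem mem_lineY {V : aff} : V ∈ lineY ↔ V.val 0 0 = 0 := Iff.rfl

theorem lie_zero_zero (V W : aff) : (⁅V, W⁆ : aff).val 0 0 = 0 := by
  have h1 := V.property.1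
  have h2 := W.property.1
  change (V.val * W.val - W.val * V.val) 0 0 = 0
  simp only [Matrix.sub_apply, Matrix.mul_apply, Fin.sum_univ_two, h1, h2]
  ring

theorem lie_zero_one (V W : aff) :
    (⁅V, W⁆ : aff).val 0 1 = V.val 0 0 * W.val 0 1 - W.val 0 0 * V.val 0 1 := by
  have h1 := V.property.2
  have h2 := W.property.2
  change (V.val * W.val - W.val * V.val) 0 1 = _
  simp only [Matrix.sub_apply, Matrix.mul_apply, Fin.sum_univ_two, h1, h2]
  ring

theorem finrank_aff : Module.finrank ℝ aff = 2 := by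
  let e : aff ≃ₗ[ℝ] ℝ × ℝ :=
    { toFun := fun Z => (Z.val 0 0, Z.val 0 1)
      map_add' := fun _ _ => rfl
      map_smul' := fun _ _ => rfl
      invFun := fun x => x.1 • genX + x.2 • genY
      left_inv := fun Z => (aff_eq_smul_add Z).symm
      right_inv := fun x => by simp }
  rw [e.finrank_eq]
  simp

theorem finrank_lineY : Module.finrank ℝ lineY = 1 := by
  refine finrank_eq_one (⟨genY, mem_lineY.2 rfl⟩ : lineY) ?_ ?_
  · intro h
    have h0 := congrArg (fun V : lineY => V.val.val 0 1) h
    simp at h0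
  · intro V
    refine ⟨V.val.val 0 1, Subtype.ext (aff_ext ?_ ?_)⟩
    · have := mem_lineY.1 V.property
      simp [this]
    · simp

/-- The Kirillov form of a point with `⟨F, Y⟩ ≠ 0` is nondegenerate. -/
theorem radical_eq_bot {F : Module.Dual ℝ aff} (hF : F genY < 0) {K : Submodule ℝ aff}
    (hK : ∀ V, V ∈ K ↔ ∀ W, F ⁅V, W⁆ = 0) : K = ⊥ := by
  refine (Submodule.eq_bot_iff _).2 fun V hV => ?_
  have h := (hK V).1 hV
  have hX := h genX
  have hY := h genY
  rw [dual_apply, lie_zero_zero, lie_zero_one] at hX hY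
  simp [hF.ne] at hX hY
  exact aff_ext hY hX

theorem isAdmissible_lineY {F : Module.Dual ℝ aff} (hF : F genY < 0) : IsAdmissible F lineY where
  subordinate V hV W hW := by
    rw [dual_apply, lie_zero_zero, lie_zero_one, mem_lineY.1 hV, mem_lineY.1 hW]
    simp
  maximal K hK := by
    rw [radical_eq_bot hF hK, finrank_aff, finrank_lineY, finrank_bot]
  pukanszky F' h := by
    rw [coadjointOrbit_of_neg hF]
    change (F + F') genY < 0
    rw [LinearMap.add_apply, h genY (mem_lineY.2 rfl), add_zero]
    exact hF

/-- By the Pukanszky condition `F + 𝔥^⊥`, a line in the open lower half-plane, is horizontal. -/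
theorem mem_iff_of_isAdmissible {F : Module.Dual ℝ aff} (hF : F genY < 0)
    {𝔥 : LieSubalgebra ℝ aff} (h : IsAdmissible F 𝔥) (V : aff) : V ∈ 𝔥 ↔ V.val 0 0 = 0 := by
  let K : Submodule ℝ aff :=
    { carrier := {V | ∀ W, F ⁅V, W⁆ = 0}
      add_mem' := fun {a b} ha hb W => by rw [add_lie, map_add, ha, hb, add_zero]
      zero_mem' := fun W => by rw [zero_lie, map_zero]
      smul_mem' := fun c x hx W => by rw [smul_lie, map_smul, hx, smul_zero] }
  have hm := h.maximal K fun _ => Iff.rfl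
  rw [radical_eq_bot hF (K := K) fun _ => Iff.rfl, finrank_aff, finrank_bot] at hm
  have h1 : Module.finrank ℝ 𝔥 = 1 := by omega
  obtain ⟨v, hv, hspan⟩ := finrank_eq_one_iff'.1 h1
  have hmem : ∀ W ∈ 𝔥, ∃ c : ℝ, W = c • v.val := fun W hW => by
    obtain ⟨c, hc⟩ := hspan ⟨W, hW⟩
    exact ⟨c, (congrArg Subtype.val hc).symm⟩
  have hv0 : v.val.val 0 0 = 0 := by
    by_contra hne
    -- the functional `k (v₀ Y* - v₁ X*)` vanishes on `𝔥`, and `k` is such that it takes the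
    -- value `-F(Y)` at `Y`
    have hp := h.pukanszky ((-F genY / v.val.val 0 0) •
      (v.val.val 0 0 • dualY - v.val.val 0 1 • dualX)) (fun W hW => by
        obtain ⟨c, rfl⟩ := hmem W hW
        rw [map_smul, LinearMap.smul_apply, LinearMap.sub_apply, LinearMap.smul_apply,
          LinearMap.smul_apply, dualX_apply, dualY_apply]
        simp only [smul_eq_mul]
        ring)
    rw [coadjointOrbit_of_neg hF] at hp
    have hp : _ < (0 : ℝ) := hp
    simp [dualX_apply, dualY_apply, hne] at hp
  have hv1 : v.val.val 0 1 ≠ 0 := fun h1 => hv (Subtype.ext (aff_ext hv0 h1))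
  constructor
  · intro hV
    obtain ⟨c, rfl⟩ := hmem V hV
    simp [hv0]
  · intro hV
    have : V = (V.val 0 1 / v.val.val 0 1) • v.val :=
      aff_ext (by simp [hV, hv0]) (by simp [hv1])
    rw [this]
    exact 𝔥.smul_mem _ v.property

theorem mem_analyticSubgroup {𝔥 : LieSubalgebra ℝ aff} (h : ∀ V : aff, V ∈ 𝔥 ↔ V.val 0 0 = 0)
    (g : Aff0) : g ∈ analyticSubgroup 𝔥 ↔ coeffA g = 1 := by
  constructor
  · intro hg
    induction hg using Subgroup.closure_induction with
    | mem x hx =>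
      obtain ⟨V, hV, rfl⟩ := hx
      rw [coeffA_expG, (h V).1 hV, Real.exp_zero]
    | one => exact coeffA_one
    | mul x y _ _ hx hy => rw [coeffA_mul, hx, hy, one_mul]
    | inv x _ hx => rw [coeffA_inv, hx, inv_one]
  · intro hg
    refine Subgroup.subset_closure ⟨coeffB g • genY, (h _).2 (by simp), Aff0.ext ?_ ?_⟩
    · rw [coeffA_expG, hg]; simp
    · rw [coeffB_expG_of_eq_zero] <;> simp

/-! ### Test functions and the partial Fourier transform -/

theorem hasDerivAt_integral_of_compact {F F' : ℝ → ℝ → ℂ} {K : Set ℝ} (hK : IsCompact K)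
    (hF : Continuous (Function.uncurry F)) (hF' : Continuous (Function.uncurry F'))
    (h0 : ∀ t, ∀ x ∉ K, F t x = 0) (h0' : ∀ t, ∀ x ∉ K, F' t x = 0)
    (hd : ∀ t x, HasDerivAt (fun t => F t x) (F' t x) t) (t : ℝ) :
    HasDerivAt (fun t => ∫ x, F t x) (∫ x, F' t x) t := by
  obtain ⟨C, hC⟩ := ((isCompact_Icc (a := t - 1) (b := t + 1)).prod hK).exists_bound_of_continuousOn
    hF'.continuousOn
  have hFt : ∀ t, Continuous (F t) := fun t => hF.comp (Continuous.prodMk_right t)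
  have hFt' : ∀ t, Continuous (F' t) := fun t => hF'.comp (Continuous.prodMk_right t)
  refine (hasDerivAt_integral_of_dominated_loc_of_deriv_le (F := F) (F' := F')
    (bound := K.indicator fun _ => C) (Icc_mem_nhds (a := t - 1) (b := t + 1) (by linarith)
    (by linarith)) ?_ ?_ ?_ ?_ ?_ ?_).2
  · exact Eventually.of_forall fun s => (hFt s).aestronglyMeasurable
  · exact (hFt t).integrable_of_hasCompactSupport (HasCompactSupport.intro hK (h0 t))
  · exact (hFt' t).aestronglyMeasurable
  · refine Eventually.of_forall fun x s hs => ?_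
    by_cases hx : x ∈ K
    · rw [Set.indicator_of_mem hx]
      exact hC (s, x) ⟨hs, hx⟩
    · rw [h0' s x hx, Set.indicator_of_notMem hx, norm_zero]
  · exact (integrable_indicator_iff hK.measurableSet).2 (integrableOn_const hK.measure_ne_top)
  · exact Eventually.of_forall fun x s _ => hd s x

variable {u : ℝ × ℝ → ℂ}

theorem IsTest.exists_compact (hu : IsTest u) :
    ∃ K : Set ℝ, IsCompact K ∧ ∀ x q, x ∉ K → u (x, q) = 0 := by
  refine ⟨Prod.fst '' tsupport u, hu.2.isCompact.image continuous_fst, fun x q hx => ?_⟩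
  by_contra h
  exact hx ⟨(x, q), subset_tsupport u h, rfl⟩

theorem IsTest.smooth_mul (hu : IsTest u) {g : ℝ × ℝ → ℂ} (hg : ContDiff ℝ ∞ g) :
    IsTest fun w => g w * u w :=
  ⟨hg.mul hu.1, hu.2.mul_left⟩

theorem IsTest.add {v : ℝ × ℝ → ℂ} (hu : IsTest u) (hv : IsTest v) :
    IsTest fun w => u w + v w :=
  ⟨hu.1.add hv.1, hu.2.add hv.2⟩

theorem IsTest.differentiable (hu : IsTest u) : Differentiable ℝ u :=
  hu.1.differentiable (by simp)

theorem IsTest.hasDerivAt_fst (hu : IsTest u) (x q : ℝ) :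
    HasDerivAt (fun x => u (x, q)) (pderiv 0 u (x, q)) x := by
  have h : DifferentiableAt ℝ (fun x => u (x, q)) x :=
    (hu.differentiable (x, q)).comp x (by fun_prop)
  simpa [pderiv] using h.hasDerivAt

theorem IsTest.hasDerivAt_snd (hu : IsTest u) (x q : ℝ) :
    HasDerivAt (fun q => u (x, q)) (pderiv 1 u (x, q)) q := by
  have h : DifferentiableAt ℝ (fun q => u (x, q)) q :=
    (hu.differentiable (x, q)).comp q (by fun_prop)
  simpa [pderiv] using h.hasDerivAt

theorem IsTest.pderiv_fst_eq (hu : IsTest u) : pderiv 0 u = fun w => fderiv ℝ u w (1, 0) := by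
  funext ⟨x, q⟩
  refine (hu.hasDerivAt_fst x q).unique ?_
  exact (hu.differentiable (x, q)).hasFDerivAt.comp_hasDerivAt x
    ((hasDerivAt_id x).prodMk (hasDerivAt_const x q))

theorem IsTest.pderiv_snd_eq (hu : IsTest u) : pderiv 1 u = fun w => fderiv ℝ u w (0, 1) := by
  funext ⟨x, q⟩
  refine (hu.hasDerivAt_snd x q).unique ?_
  exact (hu.differentiable (x, q)).hasFDerivAt.comp_hasDerivAt q
    ((hasDerivAt_const q x).prodMk (hasDerivAt_id q))

theorem IsTest.fderiv_apply (hu : IsTest u) (v : ℝ × ℝ) : IsTest fun w => fderiv ℝ u w v :=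
  ⟨(hu.1.fderiv_right (m := ∞) (by simp)).clm_apply contDiff_const,
    hu.2.fderiv_apply (𝕜 := ℝ) v⟩

theorem IsTest.pderiv_fst (hu : IsTest u) : IsTest (pderiv 0 u) :=
  hu.pderiv_fst_eq ▸ hu.fderiv_apply _

theorem IsTest.pderiv_snd (hu : IsTest u) : IsTest (pderiv 1 u) :=
  hu.pderiv_snd_eq ▸ hu.fderiv_apply _

theorem IsTest.integrable_mul (hu : IsTest u) {g : ℝ → ℂ} (hg : Continuous g) (q : ℝ) :
    Integrable fun x => g x * u (x, q) := by
  obtain ⟨K, hK, h0⟩ := hu.exists_compact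
  have hc := hu.1.continuous
  refine Continuous.integrable_of_hasCompactSupport (by fun_prop)
    (HasCompactSupport.intro hK fun x hx => ?_)
  simp [h0 x q hx]

theorem IsTest.fourierPInv_add {v : ℝ × ℝ → ℂ} (hu : IsTest u) (hv : IsTest v) (w : ℝ × ℝ) :
    fourierPInv (fun w => u w + v w) w = fourierPInv u w + fourierPInv v w := by
  simp only [fourierPInv]
  rw [← mul_add, ← integral_add (hu.integrable_mul (by fun_prop) w.2)
    (hv.integrable_mul (by fun_prop) w.2)]
  simp only [mul_add]

theorem fourierPInv_smul (g : ℝ → ℂ) (u : ℝ × ℝ → ℂ) (w : ℝ × ℝ) :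
    fourierPInv (fun w => g w.2 * u w) w = g w.2 * fourierPInv u w := by
  simp only [fourierPInv]
  rw [mul_left_comm]
  congr 1
  rw [← integral_const_mul]
  congr 1
  funext x
  ring

theorem IsTest.pderiv_fst_fourierPInv (hu : IsTest u) :
    pderiv 0 (fourierPInv u) = fourierPInv fun w => Complex.I * w.1 * u w := by
  funext ⟨p, q⟩
  obtain ⟨K, hK, h0⟩ := hu.exists_compact
  have hc := hu.1.continuous
  have h := hasDerivAt_integral_of_compact (K := K)
    (F := fun p x => Complex.exp (Complex.I * p * x) * u (x, q))
    (F' := fun p x => Complex.exp (Complex.I * p * x) * (Complex.I * x * u (x, q))) hK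
    (by fun_prop) (by fun_prop) (fun t x hx => by simp [h0 x q hx])
    (fun t x hx => by simp [h0 x q hx])
    (fun t x => by
      have h1 : HasDerivAt (fun t : ℝ => Complex.I * t * x) (Complex.I * 1 * x) t :=
        ((Complex.ofRealCLM.hasDerivAt (x := t)).const_mul Complex.I).mul_const (x : ℂ)
      exact (h1.cexp.mul_const (u (x, q))).congr_deriv (by ring)) p
  simpa [pderiv, fourierPInv] using (h.const_mul (1 / (Real.sqrt (2 * Real.pi) : ℂ))).deriv

theorem IsTest.pderiv_snd_fourierPInv (hu : IsTest u) :
    pderiv 1 (fourierPInv u) = fourierPInv (pderiv 1 u) := by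
  funext ⟨p, q⟩
  obtain ⟨K, hK, h0⟩ := hu.exists_compact
  have hc := hu.1.continuous
  have hc' := hu.pderiv_snd.1.continuous
  have h := hasDerivAt_integral_of_compact (K := K)
    (F := fun q x => Complex.exp (Complex.I * p * x) * u (x, q))
    (F' := fun q x => Complex.exp (Complex.I * p * x) * pderiv 1 u (x, q)) hK
    (by fun_prop) (by fun_prop) (fun t x hx => by simp [h0 x t hx])
    (fun t x hx => by simp [pderiv, h0 x _ hx])
    (fun t x => (hu.hasDerivAt_snd x t).const_mul _) q
  simpa [pderiv, fourierPInv] using (h.const_mul (1 / (Real.sqrt (2 * Real.pi) : ℂ))).deriv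

theorem IsTest.mul_fourierPInv (hu : IsTest u) (w : ℝ × ℝ) :
    w.1 * fourierPInv u w = Complex.I * fourierPInv (pderiv 0 u) w := by
  have hE : ∀ x : ℝ, HasDerivAt (fun x : ℝ => Complex.exp (Complex.I * w.1 * x))
      (Complex.exp (Complex.I * w.1 * x) * (Complex.I * w.1)) x := fun x => by
    have h1 : HasDerivAt (fun x : ℝ => Complex.I * w.1 * x) (Complex.I * w.1 * 1) x :=
      (Complex.ofRealCLM.hasDerivAt (x := x)).const_mul (Complex.I * w.1)
    exact h1.cexp.congr_deriv (by ring)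
  have h := integral_mul_deriv_eq_deriv_mul_of_integrable (fun x _ => hE x)
    (fun x _ => hu.hasDerivAt_fst x w.2)
    (hu.pderiv_fst.integrable_mul (by fun_prop) w.2)
    (hu.integrable_mul (by fun_prop) w.2) (hu.integrable_mul (by fun_prop) w.2)
  simp only [fourierPInv]
  rw [h, ← integral_neg, mul_left_comm, mul_left_comm Complex.I]
  congr 1
  rw [← integral_const_mul, ← integral_const_mul]
  congr 1
  funext x
  linear_combination (w.1 * Complex.exp (Complex.I * w.1 * x) * u (x, w.2)) * Complex.I_mul_I

theorem fourierPInv_eq_fourierInv (u : ℝ × ℝ → ℂ) (p q : ℝ) :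
    fourierPInv u (p, q) = 1 / (Real.sqrt (2 * Real.pi) : ℂ) *
      FourierTransformInv.fourierInv (fun x => u (x, q)) (p / (2 * Real.pi)) := by
  rw [fourierPInv, Real.fourierInv_eq']
  congr 2
  funext x
  simp only [smul_eq_mul]
  congr 2
  simp
  field_simp

/-- The smooth function with compact support `x ↦ u (x, q)`, as a Schwartz function. -/
noncomputable def IsTest.schwartz (hu : IsTest u) (q : ℝ) : SchwartzMap ℝ ℂ :=
  HasCompactSupport.toSchwartzMap (f := fun x => u (x, q))
    (by
      obtain ⟨K, hK, h0⟩ := hu.exists_compact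
      exact HasCompactSupport.intro hK fun x hx => h0 x q hx)
    (hu.1.comp (contDiff_id.prodMk contDiff_const))

theorem IsTest.fourierPInv_eq_schwartz (hu : IsTest u) (p q : ℝ) :
    fourierPInv u (p, q) = 1 / (Real.sqrt (2 * Real.pi) : ℂ) *
      (FourierTransformInv.fourierInv (hu.schwartz q) : SchwartzMap ℝ ℂ) (p / (2 * Real.pi)) := by
  rw [fourierPInv_eq_fourierInv, SchwartzMap.fourierInv_coe]
  rfl

theorem IsTest.integrable_fourierPInv (hu : IsTest u) (q : ℝ) :
    Integrable fun p => fourierPInv u (p, q) := by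
  simp only [hu.fourierPInv_eq_schwartz]
  exact ((SchwartzMap.integrable _).comp_div (by positivity)).const_mul _

/-- Fourier inversion in one variable. -/
theorem IsTest.fourierP_fourierPInv (hu : IsTest u) : fourierP (fourierPInv u) = u := by
  funext ⟨x, q⟩
  have hinv := congrArg (fun f : SchwartzMap ℝ ℂ => f x)
    (FourierTransform.fourier_fourierInv_eq (F := SchwartzMap ℝ ℂ) (hu.schwartz q))
  simp only [SchwartzMap.fourier_coe, Real.fourier_eq'] at hinv
  have hπ : (0 : ℝ) < 2 * Real.pi := by positivity
  have hs : ((Real.sqrt (2 * Real.pi) : ℝ) : ℂ) * (Real.sqrt (2 * Real.pi) : ℝ) =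
      ((2 * Real.pi : ℝ) : ℂ) := by
    rw [← Complex.ofReal_mul, Real.mul_self_sqrt hπ.le]
  have hs0 : ((Real.sqrt (2 * Real.pi) : ℝ) : ℂ) ≠ 0 :=
    Complex.ofReal_ne_zero.2 (Real.sqrt_pos.2 hπ).ne'
  -- substitute `p = 2π t` in the outer integral
  have hsub := Measure.integral_comp_div (fun t : ℝ =>
    Complex.exp (((-2 * Real.pi * inner ℝ t x : ℝ) : ℂ) * Complex.I) •
      (FourierTransformInv.fourierInv (hu.schwartz q) : SchwartzMap ℝ ℂ) t) (2 * Real.pi)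
  rw [hinv, abs_of_pos hπ] at hsub
  have hu' : (hu.schwartz q) x = u (x, q) := rfl
  rw [hu'] at hsub
  simp only [fourierP, hu.fourierPInv_eq_schwartz]
  have : ∀ p : ℝ, Complex.exp (-(Complex.I * p * x)) *
      (1 / (Real.sqrt (2 * Real.pi) : ℂ) *
        (FourierTransformInv.fourierInv (hu.schwartz q) : SchwartzMap ℝ ℂ) (p / (2 * Real.pi))) =
      1 / (Real.sqrt (2 * Real.pi) : ℂ) *
      (Complex.exp (((-2 * Real.pi * inner ℝ (p / (2 * Real.pi)) x : ℝ) : ℂ) * Complex.I) •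
        (FourierTransformInv.fourierInv (hu.schwartz q) : SchwartzMap ℝ ℂ)
          (p / (2 * Real.pi))) := by
    intro p
    rw [mul_left_comm, smul_eq_mul]
    congr 3
    simp
    field_simp
  simp only [this]
  rw [integral_const_mul, hsub, Complex.real_smul, ← hs]
  field_simp

/-! ### Moyal multiplication by a Hamiltonian function -/

theorem iHam_eq (Z : aff) : iHam Z = fun x : ℝ × ℝ =>
    Complex.I * Z.val 0 0 * x.1 - Complex.I * Z.val 0 1 * Real.exp x.2 := by
  funext x
  rw [iHam, hamiltonian, chartMinus_apply]
  push_cast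
  ring

theorem pderiv_const (i : Fin 2) (c : ℂ) : pderiv i (fun _ => c) = 0 := by
  funext x
  simp [pderiv]

theorem pderiv_fst_exp (c : ℂ) : pderiv 0 (fun x => c * Real.exp x.2) = 0 := by
  funext x
  simp [pderiv]

theorem pderiv_snd_exp (c : ℂ) :
    pderiv 1 (fun x => c * Real.exp x.2) = fun x => c * Real.exp x.2 := by
  funext x
  simpa [pderiv] using ((Real.hasDerivAt_exp x.2).ofReal_comp.const_mul c).deriv

theorem pderiv_fst_iHam (Z : aff) : pderiv 0 (iHam Z) = fun _ => Complex.I * Z.val 0 0 := by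
  funext x
  rw [iHam_eq]
  have h : HasDerivAt (fun p : ℝ => Complex.I * Z.val 0 0 * p - Complex.I * Z.val 0 1 *
      Real.exp x.2) (Complex.I * Z.val 0 0 * 1) x.1 :=
    ((Complex.ofRealCLM.hasDerivAt (x := x.1)).const_mul _).sub_const _
  simpa [pderiv] using h.deriv

theorem pderiv_snd_iHam (Z : aff) :
    pderiv 1 (iHam Z) = fun x => -(Complex.I * Z.val 0 1) * Real.exp x.2 := by
  funext x
  rw [iHam_eq]
  have h : HasDerivAt (fun q : ℝ => Complex.I * Z.val 0 0 * x.1 - Complex.I * Z.val 0 1 *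
      Real.exp q) (-(Complex.I * Z.val 0 1 * Real.exp x.2)) x.2 :=
    ((Real.hasDerivAt_exp x.2).ofReal_comp.const_mul _).const_sub _
  simpa [pderiv] using h.deriv

/-- Of the partial derivatives of order at least two of a Hamiltonian function, only those with
respect to `q` alone do not vanish. -/
theorem foldr_pderiv_iHam (Z : aff) (l : List (Fin 2)) (hl : 2 ≤ l.length) :
    l.foldr pderiv (iHam Z) =
      if ∀ i ∈ l, i = 1 then fun x : ℝ × ℝ => -(Complex.I * Z.val 0 1 : ℂ) * Real.exp x.2
      else 0 := by
  have hcases : ∀ i : Fin 2, i = 0 ∨ i = 1 := by decide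
  have h0 : ∀ i, pderiv i (0 : ℝ × ℝ → ℂ) = 0 := fun i => pderiv_const i 0
  induction l with
  | nil => simp at hl
  | cons i l ih =>
    match l, ih, hl with
    | [], _, hl => simp at hl
    | [j], _, _ =>
      simp only [List.foldr_cons, List.foldr_nil]
      rcases hcases i with rfl | rfl <;> rcases hcases j with rfl | rfl <;>
        simp only [pderiv_fst_iHam, pderiv_snd_iHam, pderiv_const, pderiv_fst_exp,
          pderiv_snd_exp] <;> simp
    | j :: k :: l, ih, _ =>
      rw [List.foldr_cons, ih (by simp)]
      split_ifs with h1 h2 h2 <;> rw [List.forall_mem_cons] at h2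
      · rw [h2.1, pderiv_snd_exp]
      · rw [(hcases i).resolve_right fun hi => h2 ⟨hi, h1⟩, pderiv_fst_exp]
      · exact absurd h2.2 h1
      · exact h0 i

theorem iterPderiv_iHam (Z : aff) {r : ℕ} (hr : 2 ≤ r) (I : Fin r → Fin 2) :
    iterPderiv I (iHam Z) =
      if I = fun _ => 1 then fun x : ℝ × ℝ => -(Complex.I * Z.val 0 1 : ℂ) * Real.exp x.2
      else 0 := by
  rw [iterPderiv, foldr_pderiv_iHam Z _ (by simpa using hr)]
  simp [funext_iff]

/-- The sum over the second multi-index is given by the term in which all indices are swapped. -/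
theorem moyalP_eq_sum (r : ℕ) (u v : ℝ × ℝ → ℂ) (x : ℝ × ℝ) :
    moyalP r u v x = ∑ I : Fin r → Fin 2, (∏ k, if I k = 0 then (1 : ℂ) else -1) *
      iterPderiv I u x * iterPderiv (fun k => 1 - I k) v x := by
  have h2 : ∀ i j : Fin 2, poissonTensor i j =
      if j = 1 - i then (if i = 0 then (1 : ℂ) else -1) else 0 := by
    intro i j
    fin_cases i <;> fin_cases j <;> simp [poissonTensor]
  refine Finset.sum_congr rfl fun I _ => ?_
  rw [Finset.sum_eq_single (fun k => 1 - I k)]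
  · simp [h2]
  · intro J _ hJ
    obtain ⟨k, hk⟩ := Function.ne_iff.1 hJ
    rw [Finset.prod_eq_zero (Finset.mem_univ k) (by rw [h2, if_neg hk]), zero_mul, zero_mul]
  · simp

theorem moyalP_iHam (Z : aff) {r : ℕ} (hr : 2 ≤ r) (v : ℝ × ℝ → ℂ) (x : ℝ × ℝ) :
    moyalP r (iHam Z) v x = (-1) ^ r * (-(Complex.I * Z.val 0 1) * Real.exp x.2) *
      iterPderiv (fun _ : Fin r => 0) v x := by
  rw [moyalP_eq_sum, Finset.sum_eq_single (fun _ => 1)]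
  · rw [iterPderiv_iHam Z hr, if_pos rfl]
    simp
  · intro I _ hI
    rw [iterPderiv_iHam Z hr, if_neg hI]
    simp
  · simp

theorem moyalP_zero (u v : ℝ × ℝ → ℂ) (x : ℝ × ℝ) : moyalP 0 u v x = u x * v x := by
  simp [moyalP, iterPderiv]

theorem moyalP_one (u v : ℝ × ℝ → ℂ) (x : ℝ × ℝ) :
    moyalP 1 u v x = pderiv 0 u x * pderiv 1 v x - pderiv 1 u x * pderiv 0 v x := by
  rw [moyalP_eq_sum, ← (Equiv.funUnique (Fin 1) (Fin 2)).symm.sum_comp]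
  simp [iterPderiv, sub_eq_add_neg]

theorem IsTest.iterPderiv_fourierPInv (hu : IsTest u) (r : ℕ) :
    iterPderiv (fun _ : Fin r => 0) (fourierPInv u) =
      fourierPInv fun w => (Complex.I * w.1) ^ r * u w := by
  have hr : ∀ r : ℕ, ContDiff ℝ ∞ fun w : ℝ × ℝ => (Complex.I * w.1) ^ r := fun r =>
    (contDiff_const.mul (Complex.ofRealCLM.contDiff.comp contDiff_fst)).pow r
  induction r with
  | zero => simp [iterPderiv]
  | succ r ih =>
    have h : iterPderiv (fun _ : Fin (r + 1) => 0) (fourierPInv u) =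
        pderiv 0 (iterPderiv (fun _ : Fin r => 0) (fourierPInv u)) := by
      simp [iterPderiv, List.ofFn_succ]
    rw [h, ih, (hu.smooth_mul (hr r)).pderiv_fst_fourierPInv]
    congr 1
    funext w
    ring

/-- Termwise integration of the exponential series of `e^{-x/2}`. -/
theorem IsTest.hasSum_fourierPInv (hu : IsTest u) (w : ℝ × ℝ) :
    HasSum (fun r : ℕ => fourierPInv (fun w => (-(w.1 : ℂ) / 2) ^ r / r.factorial * u w) w)
      (fourierPInv (fun w => Complex.exp (-(w.1 : ℂ) / 2) * u w) w) := by
  have hexp : ∀ z : ℂ, HasSum (fun r : ℕ => z ^ r / r.factorial) (Complex.exp z) := fun z => by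
    rw [Complex.exp_eq_exp_ℂ]
    exact NormedSpace.expSeries_div_hasSum_exp z
  have hexpR : ∀ z : ℝ, HasSum (fun r : ℕ => z ^ r / r.factorial) (Real.exp z) := fun z => by
    rw [Real.exp_eq_exp_ℝ]
    exact NormedSpace.expSeries_div_hasSum_exp z
  have hc := hu.1.continuous
  have hb : ∀ x : ℝ, HasSum (fun r : ℕ => (|x| / 2) ^ r / r.factorial * ‖u (x, w.2)‖)
      (Real.exp (|x| / 2) * ‖u (x, w.2)‖) := fun x => (hexpR _).mul_right _
  refine HasSum.mul_left _ (hasSum_integral_of_dominated_convergence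
    (fun (r : ℕ) x => (|x| / 2) ^ r / r.factorial * ‖u (x, w.2)‖) ?_ ?_ ?_ ?_ ?_)
  · intro r
    exact Continuous.aestronglyMeasurable (by fun_prop)
  · intro r
    refine Eventually.of_forall fun x => le_of_eq ?_
    have h1 : ‖Complex.exp (Complex.I * w.1 * x)‖ = 1 := by
      rw [Complex.norm_exp]
      simp
    rw [norm_mul, h1, one_mul, norm_mul, norm_div, norm_pow, norm_div, norm_neg,
      Complex.norm_real, Complex.norm_natCast, Real.norm_eq_abs]
    simp
  · exact Eventually.of_forall fun x => (hb x).summable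
  · have h := (hu.integrable_mul (g := fun x : ℝ => (Real.exp (|x| / 2) : ℂ)) (by fun_prop)
      w.2).norm
    refine h.congr (Eventually.of_forall fun x => ?_)
    change _ = ∑' r : ℕ, (|x| / 2) ^ r / r.factorial * ‖u (x, w.2)‖
    rw [(hb x).tsum_eq]
    simp only
    rw [norm_mul, Complex.norm_real, Real.norm_eq_abs, Real.abs_exp]
  · exact Eventually.of_forall fun x => ((hexp _).mul_right _).mul_left _

/-- The operator `ℓ̂_Z = α (½ ∂_q - ∂_x) - i β e^{q - x/2}` for `Z = α X + β Y`. -/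
noncomputable def ellHatFormula (Z : aff) (u : ℝ × ℝ → ℂ) (w : ℝ × ℝ) : ℂ :=
  (-(Z.val 0 0 : ℂ) * pderiv 0 u w + Z.val 0 0 / 2 * pderiv 1 u w) +
    -(Complex.I * Z.val 0 1) * Real.exp w.2 * (Complex.exp (-(w.1 : ℂ) / 2) * u w)

theorem contDiff_cexp_fst : ContDiff ℝ ∞ fun w : ℝ × ℝ => Complex.exp (-(w.1 : ℂ) / 2) :=
  ((Complex.ofRealCLM.contDiff.comp contDiff_fst).neg.div_const 2).cexp

theorem contDiff_rexp_snd : ContDiff ℝ ∞ fun w : ℝ × ℝ => (Real.exp w.2 : ℂ) :=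
  Complex.ofRealCLM.contDiff.comp (Real.contDiff_exp.comp contDiff_snd)

theorem IsTest.ellHatFormula (hu : IsTest u) (Z : aff) : IsTest (ellHatFormula Z u) :=
  ((hu.pderiv_fst.smooth_mul contDiff_const).add (hu.pderiv_snd.smooth_mul contDiff_const)).add
    ((hu.smooth_mul contDiff_cexp_fst).smooth_mul (contDiff_const.mul contDiff_rexp_snd))

theorem IsTest.fourierPInv_ellHatFormula (hu : IsTest u) (Z : aff) (w : ℝ × ℝ) :
    fourierPInv (AffPlane.ellHatFormula Z u) w =
      Complex.I * Z.val 0 0 * (w.1 * fourierPInv u w) +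
        Z.val 0 0 / 2 * fourierPInv (pderiv 1 u) w +
      -(Complex.I * Z.val 0 1) * Real.exp w.2 *
        fourierPInv (fun w => Complex.exp (-(w.1 : ℂ) / 2) * u w) w := by
  have h1 := hu.pderiv_fst.smooth_mul (g := fun _ => -(Z.val 0 0 : ℂ)) contDiff_const
  have h2 := hu.pderiv_snd.smooth_mul (g := fun _ => (Z.val 0 0 / 2 : ℂ)) contDiff_const
  have h3 := (hu.smooth_mul contDiff_cexp_fst).smooth_mul
    ((contDiff_const (c := -(Complex.I * Z.val 0 1))).mul contDiff_rexp_snd)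
  refine ((h1.add h2).fourierPInv_add h3 w).trans ?_
  rw [h1.fourierPInv_add h2 w, fourierPInv_smul (fun _ => -(Z.val 0 0 : ℂ)),
    fourierPInv_smul (fun _ => (Z.val 0 0 / 2 : ℂ)),
    fourierPInv_smul (fun q => -(Complex.I * Z.val 0 1) * Real.exp q), hu.mul_fourierPInv]
  linear_combination (-(Z.val 0 0 : ℂ) * fourierPInv (pderiv 0 u) w) * Complex.I_mul_I

/-- With `v = F_p⁻¹ u`, the terms of order `r` of `i Z̃ ⋆ v` are
`-i β e^q F_p⁻¹ ((-x/2)^r / r! · u)`, to which `r = 0` adds `i α p v` and `r = 1` adds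
`½ α ∂_q v`. -/
theorem IsTest.hasSum_moyalTerm (hu : IsTest u) (Z : aff) (x : ℝ × ℝ) :
    HasSum (fun r => moyalTerm r (iHam Z) (fourierPInv u) x)
      (fourierPInv (AffPlane.ellHatFormula Z u) x) := by
  have hs := (hu.hasSum_fourierPInv x).mul_left (-(Complex.I * Z.val 0 1) * Real.exp x.2)
  have h0 := hasSum_ite_eq 0 (Complex.I * Z.val 0 0 * (x.1 * fourierPInv u x))
  have h1 := hasSum_ite_eq 1 (Z.val 0 0 / 2 * fourierPInv (pderiv 1 u) x)
  rw [hu.fourierPInv_ellHatFormula]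
  convert (h0.add h1).add hs using 1
  funext r
  have hc : fourierPInv (fun w => (-(w.1 : ℂ) / 2) ^ r / r.factorial * u w) x =
      (1 / (r.factorial : ℂ) * (1 / (2 * Complex.I)) ^ r * (-1) ^ r) *
        fourierPInv (fun w => (Complex.I * w.1) ^ r * u w) x := by
    rw [← fourierPInv_smul
      (fun _ => 1 / (r.factorial : ℂ) * (1 / (2 * Complex.I)) ^ r * (-1) ^ r)]
    congr 1
    funext w
    have hb : -(w.1 : ℂ) / 2 = 1 / (2 * Complex.I) * (-1) * (Complex.I * w.1) := by
      field_simp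
    rw [hb, mul_pow, mul_pow]
    ring
  rw [hc, moyalTerm]
  match r with
  | 0 =>
    rw [moyalP_zero, iHam_eq]
    simp
    ring
  | 1 =>
    rw [moyalP_one, pderiv_fst_iHam, pderiv_snd_iHam, hu.pderiv_snd_fourierPInv,
      hu.pderiv_fst_fourierPInv]
    simp
    field_simp
    linear_combination (-(Z.val 0 0 : ℂ) * fourierPInv (pderiv 1 u) x) * Complex.I_sq
  | r + 2 =>
    rw [moyalP_iHam Z (by omega), hu.iterPderiv_fourierPInv]
    simp
    ring

theorem IsTest.ell_fourierPInv (hu : IsTest u) (Z : aff) :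
    ell Z (fourierPInv u) = fourierPInv (AffPlane.ellHatFormula Z u) :=
  funext fun x => (hu.hasSum_moyalTerm Z x).tsum_eq

theorem IsTest.ellHat_eq (hu : IsTest u) (Z : aff) : ellHat Z u = AffPlane.ellHatFormula Z u := by
  rw [ellHat, hu.ell_fourierPInv, (hu.ellHatFormula Z).fourierP_fourierPInv]

/-! ### The logarithmic coordinate on the half-line -/

/-- The coordinate `s ↦ -e^s` on the half-line `y < 0`. -/
noncomputable def negExp (s : ℝ) : ℝ := -Real.exp s

theorem negExp_neg (s : ℝ) : negExp s < 0 := neg_neg_of_pos (Real.exp_pos s)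

theorem log_neg_negExp (s : ℝ) : Real.log (-negExp s) = s := by simp [negExp]

theorem negExp_log_neg {y : ℝ} (hy : y < 0) : negExp (Real.log (-y)) = y := by
  rw [negExp, Real.exp_log (neg_pos.2 hy), neg_neg]

@[fun_prop]
theorem continuous_negExp : Continuous negExp := Real.continuous_exp.neg

theorem map_negExp : Measure.map negExp volume = muMinus := by
  ext A hA
  have hT : MeasurableSet (negExp ⁻¹' A) := continuous_negExp.measurable hA
  have himage : negExp '' (negExp ⁻¹' A) = A ∩ Set.Iio 0 := by
    rw [Set.image_preimage_eq_inter_range]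
    congr 1
    ext y
    exact ⟨fun ⟨s, hs⟩ => hs ▸ negExp_neg s, fun hy => ⟨_, negExp_log_neg hy⟩⟩
  have h := lintegral_image_eq_lintegral_abs_deriv_mul (f := negExp) (f' := negExp) hT
    (fun s _ => (Real.hasDerivAt_exp s).neg.hasDerivWithinAt)
    (Function.LeftInverse.injective (g := fun y => Real.log (-y)) log_neg_negExp).injOn
    (fun y => ENNReal.ofReal (1 / |y|))
  rw [himage] at h
  rw [Measure.map_apply continuous_negExp.measurable hA, muMinus, withDensity_apply _ hA,
    Measure.restrict_restrict hA, h]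
  have h1 : ∀ s, ENNReal.ofReal |negExp s| * ENNReal.ofReal (1 / |negExp s|) = 1 := fun s => by
    rw [← ENNReal.ofReal_mul (abs_nonneg _), mul_one_div_cancel
      (abs_pos.2 (negExp_neg s).ne).ne', ENNReal.ofReal_one]
  simp only [h1, setLIntegral_one]

theorem measurePreserving_negExp : MeasurePreserving negExp volume muMinus :=
  ⟨continuous_negExp.measurable, map_negExp⟩

instance : SFinite muMinus := map_negExp ▸ inferInstance

theorem mul_negExp {a : ℝ} (ha : 0 < a) (s : ℝ) : a * negExp s = negExp (s + Real.log a) := by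
  rw [negExp, negExp, Real.exp_add, Real.exp_log ha]
  ring

theorem measurePreserving_mul {a : ℝ} (ha : 0 < a) :
    MeasurePreserving (fun y => a * y) muMinus muMinus := by
  refine ⟨by fun_prop, ?_⟩
  conv_lhs => rw [← map_negExp]
  have hcomp : (fun y => a * y) ∘ negExp = negExp ∘ fun s => s + Real.log a :=
    funext fun s => mul_negExp ha s
  rw [Measure.map_map (by fun_prop) continuous_negExp.measurable, hcomp,
    ← Measure.map_map continuous_negExp.measurable (by fun_prop), map_add_right_eq_self, map_negExp]

theorem ae_muMinus_of_ae {P : ℝ → Prop} (hP : ∀ᵐ s, P (negExp s)) : ∀ᵐ y ∂muMinus, P y := by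
  have hemb : MeasurableEmbedding negExp := continuous_negExp.measurableEmbedding
    (Function.LeftInverse.injective (g := fun y => Real.log (-y)) log_neg_negExp)
  rw [← map_negExp]
  exact hemb.ae_map_iff.2 hP

/-- An `L²` function on the half-line in the logarithmic coordinate. -/
noncomputable def toLine (f : HMinus) (s : ℝ) : ℂ := (f : ℝ → ℂ) (negExp s)

theorem memLp_toLine (f : HMinus) : MemLp (toLine f) 2 volume :=
  (Lp.memLp f).comp_measurePreserving measurePreserving_negExp

theorem ae_eq_iff_toLine {f : HMinus} {F : ℝ → ℂ} :
    (f : ℝ → ℂ) =ᵐ[muMinus] F ↔ toLine f =ᵐ[volume] fun s => F (negExp s) :=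
  ⟨measurePreserving_negExp.quasiMeasurePreserving.ae_eq_comp,
    fun h => ae_muMinus_of_ae (P := fun y => (f : ℝ → ℂ) y = F y) h⟩

theorem toLine_injective {f g : HMinus} (h : toLine f =ᵐ[volume] toLine g) : f = g :=
  Lp.ext (ae_eq_iff_toLine.2 h)

theorem edist_eq_toLine (f g : HMinus) :
    edist f g = eLpNorm (fun s => toLine f s - toLine g s) 2 volume := by
  rw [Lp.edist_def, ← eLpNorm_comp_measurePreserving
    ((Lp.aestronglyMeasurable f).sub (Lp.aestronglyMeasurable g)) measurePreserving_negExp]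
  rfl

theorem toLine_sub (f g : HMinus) :
    toLine (f - g) =ᵐ[volume] fun s => toLine f s - toLine g s :=
  ae_eq_iff_toLine.1 (Lp.coeFn_sub f g)

theorem toLine_add (f g : HMinus) :
    toLine (f + g) =ᵐ[volume] fun s => toLine f s + toLine g s :=
  ae_eq_iff_toLine.1 (Lp.coeFn_add f g)

theorem toLine_smul (c : ℂ) (f : HMinus) :
    toLine (c • f) =ᵐ[volume] fun s => c * toLine f s :=
  ae_eq_iff_toLine.1 (Lp.coeFn_smul c f)

theorem toLine_zero : toLine 0 =ᵐ[volume] fun _ => 0 :=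
  ae_eq_iff_toLine.1 (Lp.coeFn_zero ℂ 2 muMinus)

/-- The element of `L²((-∞, 0), dy/|y|)` given by an `L²` function of `s = log (-y)`. -/
theorem exists_toLine_eq {ψ : ℝ → ℂ} (hψ : MemLp ψ 2 volume) :
    ∃ f : HMinus, toLine f =ᵐ[volume] ψ := by
  have h : MemLp (fun y => ψ (Real.log (-y))) 2 muMinus := by
    have hemb : MeasurableEmbedding negExp := continuous_negExp.measurableEmbedding
      (Function.LeftInverse.injective (g := fun y => Real.log (-y)) log_neg_negExp)
    rw [← map_negExp, hemb.memLp_map_measure_iff]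
    simpa only [Function.comp_def, log_neg_negExp] using hψ
  refine ⟨h.toLp _, ?_⟩
  simpa only [log_neg_negExp] using ae_eq_iff_toLine.1 h.coeFn_toLp

/-- The smooth functions with compact support on the line. -/
def IsTestLine (ψ : ℝ → ℂ) : Prop := ContDiff ℝ ∞ ψ ∧ HasCompactSupport ψ

theorem IsTestLine.exists_toLine_eq {ψ : ℝ → ℂ} (hψ : IsTestLine ψ) :
    ∃ f : HMinus, toLine f =ᵐ[volume] ψ :=
  AffPlane.exists_toLine_eq (hψ.1.continuous.memLp_of_hasCompactSupport hψ.2)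

/-- The vectors of `L²((-∞, 0), dy/|y|)` that are smooth with compact support in `y < 0`. -/
def testVectors : Set HMinus := {f | ∃ ψ, IsTestLine ψ ∧ toLine f =ᵐ[volume] ψ}

theorem dense_testVectors : Dense testVectors := by
  intro f
  refine EMetric.mem_closure_iff.2 fun ε hε => ?_
  obtain ⟨δ, hδ, hδε⟩ := ENNReal.lt_iff_exists_real_btwn.1 hε
  obtain ⟨hδ, hδε⟩ := hδε
  have hδ0 : 0 < δ := by simpa using hδ
  obtain ⟨ψ, hc, hs, hψ⟩ := (memLp_toLine f).exist_eLpNorm_sub_le (by simp) (by simp) hδ0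
  obtain ⟨g, hg⟩ := IsTestLine.exists_toLine_eq ⟨hs, hc⟩
  refine ⟨g, ⟨ψ, ⟨hs, hc⟩, hg⟩, ?_⟩
  rw [edist_eq_toLine]
  refine lt_of_le_of_lt (le_of_eq_of_le (eLpNorm_congr_ae ?_) hψ) hδε
  filter_upwards [hg] with s hs
  simp [hs]

/-- Dominated convergence in `L²` for functions with supports in a common compact set. -/
theorem tendsto_eLpNorm_zero {ι : Type*} {l : Filter ι} [l.IsCountablyGenerated]
    {F : ι → ℝ → ℂ} {K : Set ℝ} (hK : IsCompact K) (C : ℝ)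
    (hm : ∀ᶠ i in l, AEStronglyMeasurable (F i) volume)
    (hb : ∀ᶠ i in l, ∀ s, ‖F i s‖ ≤ C) (h0 : ∀ᶠ i in l, ∀ s ∉ K, F i s = 0)
    (hlim : ∀ s, Tendsto (fun i => F i s) l (𝓝 0)) :
    Tendsto (fun i => eLpNorm (F i) 2 volume) l (𝓝 0) := by
  have h : Tendsto (fun i => ∫⁻ s, ‖F i s‖ₑ ^ (2 : ℝ)) l (𝓝 (∫⁻ _ : ℝ, 0)) := by
    refine tendsto_lintegral_filter_of_dominated_convergence'
      (K.indicator fun _ => ENNReal.ofReal C ^ (2 : ℝ)) ?_ ?_ ?_ ?_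
    · exact hm.mono fun i hi => hi.enorm.pow_const _
    · filter_upwards [hb, h0] with i hi hi0
      refine Eventually.of_forall fun s => ?_
      by_cases hs : s ∈ K
      · rw [Set.indicator_of_mem hs]
        gcongr
        rw [← ofReal_norm]
        exact ENNReal.ofReal_le_ofReal (hi s)
      · simp [hi0 s hs]
    · rw [lintegral_indicator_const hK.measurableSet]
      exact ENNReal.mul_ne_top (by simp) hK.measure_ne_top
    · refine Eventually.of_forall fun s => ?_
      have := ((ENNReal.continuous_rpow_const (y := 2)).tendsto _).comp
        ((continuous_enorm.tendsto _).comp (hlim s))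
      simpa [Function.comp_def] using this
  have h2 := ((ENNReal.continuous_rpow_const (y := 1 / 2)).tendsto _).comp h
  simpa [eLpNorm_eq_lintegral_rpow_enorm_toReal, Function.comp_def] using h2

/-! ### The representation -/

theorem norm_cexp_I_mul (b y : ℝ) : ‖Complex.exp (Complex.I * b * y)‖ = 1 := by
  rw [Complex.norm_exp]
  simp

/-- The function `y ↦ e^{iby} f(ay)`. -/
noncomputable def repFun (g : Aff0) (f : ℝ → ℂ) (y : ℝ) : ℂ :=
  Complex.exp (Complex.I * coeffB g * y) * f (coeffA g * y)

theorem memLp_repFun (g : Aff0) (f : HMinus) : MemLp (repFun g f) 2 muMinus := by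
  have h := (Lp.memLp f).comp_measurePreserving (measurePreserving_mul (coeffA_pos g))
  refine h.congr_norm ?_ (Eventually.of_forall fun y => ?_)
  · exact (Continuous.aestronglyMeasurable (by fun_prop)).mul h.1
  · simp [repFun, norm_cexp_I_mul]

/-- The isometry `f ↦ (y ↦ e^{iby} f(ay))`. -/
noncomputable def repIsometry (g : Aff0) : HMinus →ₗᵢ[ℂ] HMinus where
  toFun f := (memLp_repFun g f).toLp _
  map_add' f₁ f₂ := by
    refine Lp.ext ?_
    filter_upwards [(memLp_repFun g (f₁ + f₂)).coeFn_toLp, (memLp_repFun g f₁).coeFn_toLp,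
      (memLp_repFun g f₂).coeFn_toLp, Lp.coeFn_add ((memLp_repFun g f₁).toLp _)
      ((memLp_repFun g f₂).toLp _), (measurePreserving_mul
      (coeffA_pos g)).quasiMeasurePreserving.ae_eq_comp (Lp.coeFn_add f₁ f₂)] with y h1 h2 h3 h4 h5
    simp only [Function.comp_apply, Pi.add_apply] at h4 h5
    rw [h1, h4, h2, h3, repFun, h5, repFun, repFun, mul_add]
  map_smul' c f := by
    refine Lp.ext ?_
    filter_upwards [(memLp_repFun g (c • f)).coeFn_toLp, (memLp_repFun g f).coeFn_toLp,
      Lp.coeFn_smul c ((memLp_repFun g f).toLp _), (measurePreserving_mul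
      (coeffA_pos g)).quasiMeasurePreserving.ae_eq_comp (Lp.coeFn_smul c f)] with y h1 h2 h3 h4
    simp only [Function.comp_apply, Pi.smul_apply, smul_eq_mul, RingHom.id_apply] at h3 h4 ⊢
    rw [h1, h3, h2, repFun, h4, repFun, mul_left_comm]
  norm_map' f := by
    have h := eLpNorm_comp_measurePreserving (p := 2) (Lp.aestronglyMeasurable f)
      (measurePreserving_mul (coeffA_pos g))
    change ‖(memLp_repFun g f).toLp _‖ = ‖f‖
    rw [Lp.norm_toLp, Lp.norm_def, ← h]
    congr 1
    exact eLpNorm_congr_norm_ae (Eventually.of_forall fun y => by simp [repFun, norm_cexp_I_mul])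

theorem coeFn_repIsometry (g : Aff0) (f : HMinus) :
    (repIsometry g f : ℝ → ℂ) =ᵐ[muMinus] repFun g f :=
  (memLp_repFun g f).coeFn_toLp

theorem repIsometry_mul (g h : Aff0) (f : HMinus) :
    repIsometry (g * h) f = repIsometry g (repIsometry h f) := by
  refine Lp.ext ?_
  filter_upwards [coeFn_repIsometry (g * h) f, coeFn_repIsometry g (repIsometry h f),
    (measurePreserving_mul (coeffA_pos g)).quasiMeasurePreserving.ae_eq_comp
      (coeFn_repIsometry h f)] with y h1 h2 h3
  simp only [Function.comp_apply] at h3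
  rw [h1, h2, repFun, repFun, h3, repFun, ← mul_assoc, ← Complex.exp_add, coeffA_mul, coeffB_mul]
  congr 2
  · push_cast
    ring
  · ring

theorem repIsometry_one (f : HMinus) : repIsometry 1 f = f := by
  refine Lp.ext ?_
  filter_upwards [coeFn_repIsometry 1 f] with y h1
  rw [h1, repFun]
  simp

theorem toLine_repIsometry (g : Aff0) (f : HMinus) : toLine (repIsometry g f) =ᵐ[volume]
    fun s => Complex.exp (Complex.I * coeffB g * negExp s) *
      toLine f (s + Real.log (coeffA g)) := by
  filter_upwards [ae_eq_iff_toLine.1 (coeFn_repIsometry g f)] with s hs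
  rw [hs, repFun, mul_negExp (coeffA_pos g), toLine]

theorem toLine_repIsometry_of_ae_eq (g : Aff0) {f : HMinus} {ψ : ℝ → ℂ}
    (h : toLine f =ᵐ[volume] ψ) : toLine (repIsometry g f) =ᵐ[volume]
    fun s => Complex.exp (Complex.I * coeffB g * negExp s) * ψ (s + Real.log (coeffA g)) := by
  filter_upwards [toLine_repIsometry g f, (measurePreserving_add_right volume
    (Real.log (coeffA g))).quasiMeasurePreserving.ae_eq_comp h] with s h1 h2
  simp only [Function.comp_apply] at h2
  rw [h1, h2]

theorem exists_bound_support {ψ : ℝ → ℂ} (hψ : HasCompactSupport ψ) :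
    ∃ R : ℝ, ∀ s, R < |s| → ψ s = 0 := by
  obtain ⟨R, hR⟩ := hψ.isCompact.isBounded.exists_norm_le
  refine ⟨R, fun s hs => ?_⟩
  by_contra h
  exact absurd (hR s (subset_tsupport ψ h)) (not_le.2 hs)

/-- Strong continuity at the identity. -/
theorem tendsto_repIsometry_one (f : HMinus) :
    Tendsto (fun g => repIsometry g f) (𝓝 1) (𝓝 f) := by
  have htest : ∀ f ∈ testVectors, Tendsto (fun g => repIsometry g f) (𝓝 1) (𝓝 f) := by
    rintro f ⟨ψ, hψ, hf⟩
    obtain ⟨R, hR⟩ := exists_bound_support hψ.2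
    have hψc := hψ.1.continuous
    obtain ⟨C, hC⟩ := hψ.2.exists_bound_of_continuous hψc
    have hlim : Tendsto (fun x : ℝ × ℝ => eLpNorm (fun s =>
        Complex.exp (Complex.I * x.2 * negExp s) * ψ (s + x.1) - ψ s) 2 volume)
        (𝓝 (0, 0)) (𝓝 0) := by
      refine tendsto_eLpNorm_zero (isCompact_Icc (a := -(R + 1)) (b := R + 1)) (C + C) ?_ ?_ ?_ ?_
      · exact Eventually.of_forall fun x => Continuous.aestronglyMeasurable (by fun_prop)
      · refine Eventually.of_forall fun x s => (norm_sub_le _ _).trans (add_le_add ?_ (hC s))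
        rw [norm_mul, norm_cexp_I_mul, one_mul]
        exact hC _
      · filter_upwards [(continuous_fst.tendsto (0, 0)).eventually
          (Metric.ball_mem_nhds (0 : ℝ) one_pos)] with x hx s hs
        rw [dist_zero_right, Real.norm_eq_abs] at hx
        have hs : R + 1 < |s| := by
          by_contra h
          exact hs (abs_le.1 (not_lt.1 h))
        have h1 : |s| ≤ |s + x.1| + |x.1| := by
          simpa using abs_sub (s + x.1) x.1
        rw [hR s (by linarith), hR (s + x.1) (by linarith)]
        simp
      · intro s
        have hc : Continuous fun x : ℝ × ℝ =>
          Complex.exp (Complex.I * x.2 * negExp s) * ψ (s + x.1) - ψ s := by fun_prop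
        simpa using hc.tendsto (0, 0)
    have hcoord : Tendsto (fun g : Aff0 => (Real.log (coeffA g), coeffB g)) (𝓝 1) (𝓝 (0, 0)) := by
      have hA : Tendsto (fun g : Aff0 => Real.log (coeffA g)) (𝓝 1) (𝓝 0) := by
        simpa [Function.comp_def] using (Real.continuousAt_log (coeffA_pos 1).ne').tendsto.comp
          (continuous_coeffA.tendsto 1)
      have hB : Tendsto coeffB (𝓝 1) (𝓝 0) := by simpa using continuous_coeffB.tendsto 1
      exact hA.prodMk_nhds hB
    rw [tendsto_iff_edist_tendsto_0]
    refine (hlim.comp hcoord).congr fun g => ?_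
    rw [edist_eq_toLine]
    refine eLpNorm_congr_ae ?_
    filter_upwards [hf, toLine_repIsometry_of_ae_eq g hf] with s h1 h2
    rw [h1, h2]
  -- the operators are isometries, so that test vectors suffice
  rw [Metric.tendsto_nhds]
  intro ε hε
  obtain ⟨f', hf', hd⟩ := Metric.dense_iff.1 dense_testVectors f (ε / 3) (by positivity)
  filter_upwards [Metric.tendsto_nhds.1 (htest f' hd) (ε / 3) (by positivity)] with g hg
  have h1 : dist (repIsometry g f) (repIsometry g f') = dist f f' :=
    (repIsometry g).isometry.dist_eq _ _
  rw [Metric.mem_ball] at hf'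
  have h2 := dist_triangle4 (repIsometry g f) (repIsometry g f') f' f
  rw [h1, dist_comm f f'] at h2
  linarith

/-- The unitary representation `(T(g)f)(y) = e^{iby} f(ay)`. -/
noncomputable def repMinus : UnitaryRep Aff0 HMinus where
  act :=
    { toFun := fun g =>
        { toFun := repIsometry g
          invFun := repIsometry g⁻¹
          map_add' := (repIsometry g).map_add
          map_smul' := (repIsometry g).map_smul
          left_inv := fun f => by rw [← repIsometry_mul, inv_mul_cancel, repIsometry_one]
          right_inv := fun f => by rw [← repIsometry_mul, mul_inv_cancel, repIsometry_one]
          norm_map' := (repIsometry g).norm_map }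
      map_one' := LinearIsometryEquiv.ext repIsometry_one
      map_mul' := fun g h => LinearIsometryEquiv.ext (repIsometry_mul g h) }
  continuous_act f := by
    refine continuous_iff_continuousAt.2 fun g => ?_
    have h1 : Tendsto (fun h : Aff0 => g⁻¹ * h) (𝓝 g) (𝓝 1) := by
      simpa using (continuous_const_mul g⁻¹).tendsto g
    have h2 := ((repIsometry g).continuous.tendsto f).comp ((tendsto_repIsometry_one f).comp h1)
    refine h2.congr fun h => ?_
    change repIsometry g (repIsometry (g⁻¹ * h) f) = repIsometry h f
    rw [← repIsometry_mul, mul_inv_cancel_left]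

theorem repMinus_act (g : Aff0) (f : HMinus) : repMinus.act g f = repIsometry g f := rfl

/-! ### Irreducibility -/

instance : SigmaFinite muMinus := by
  have : SigmaFinite ((volume.restrict (Set.Iio (0 : ℝ))).withDensity
      fun y => ENNReal.ofReal (1 / |y|)) := SigmaFinite.withDensity_ofReal _
  exact this

/-- Injectivity of the Fourier transform of integrable functions, from its self-adjointness and
the Fourier inversion formula for test functions. -/
theorem ae_eq_zero_of_integral_cexp_eq_zero {k : ℝ → ℂ} (hk : Integrable k muMinus)
    (h : ∀ b : ℝ, ∫ y, Complex.exp (Complex.I * b * y) * k y ∂muMinus = 0) :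
    k =ᵐ[muMinus] 0 := by
  refine ae_eq_zero_of_integral_contDiff_smul_eq_zero hk.locallyIntegrable fun g hg hgc => ?_
  let G : SchwartzMap ℝ ℂ := HasCompactSupport.toSchwartzMap (f := fun x => (g x : ℂ))
    (hgc.comp_left Complex.ofReal_zero) (Complex.ofRealCLM.contDiff.comp hg)
  let φ : SchwartzMap ℝ ℂ := FourierTransformInv.fourierInv G
  have hφ : ∀ y, VectorFourier.fourierIntegral Real.fourierChar volume (innerₗ ℝ) φ y = g y :=
    fun y => congrArg (fun f : SchwartzMap ℝ ℂ => f y)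
      (FourierTransform.fourier_fourierInv_eq (F := SchwartzMap ℝ ℂ) G)
  have hflip := VectorFourier.integral_fourierIntegral_smul_eq_flip (L := innerₗ ℝ)
    (μ := volume) (ν := muMinus) Real.continuous_fourierChar (by fun_prop) φ.integrable hk
  simp only [hφ] at hflip
  have hz : ∀ x,
      VectorFourier.fourierIntegral Real.fourierChar muMinus (innerₗ ℝ).flip k x = 0 := by
    intro x
    rw [← h (-(2 * Real.pi * x))]
    refine integral_congr_ae (Eventually.of_forall fun y => ?_)
    simp only [Circle.smul_def, smul_eq_mul, Real.fourierChar_apply]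
    congr 2
    simp
    ring
  simp only [hz, smul_zero, integral_zero] at hflip
  rw [← hflip]
  rfl

/-- For nonzero `f` and `h`, some `T(g)f` is not orthogonal to `h`. -/
theorem repMinus_orthogonal {f h : HMinus}
    (hfh : ∀ g, inner ℂ h (repIsometry g f) = 0) : f = 0 ∨ h = 0 := by
  have key : ∀ c : ℝ, ∀ᵐ s, toLine f (s + c) * toLine h s = 0 := by
    intro c
    have hint : Integrable (fun y => (f : ℝ → ℂ) (Real.exp c * y) *
        starRingEnd ℂ ((h : ℝ → ℂ) y)) muMinus := by
      have h1 := (Lp.memLp f).comp_measurePreserving (measurePreserving_mul (Real.exp_pos c))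
      exact h1.integrable_mul (Lp.memLp h).star
    have hz := ae_eq_zero_of_integral_cexp_eq_zero hint fun b => by
      rw [← hfh (affMk (Real.exp c) b (Real.exp_pos c)), L2.inner_def]
      refine integral_congr_ae ?_
      filter_upwards [coeFn_repIsometry (affMk (Real.exp c) b (Real.exp_pos c)) f] with y hy
      rw [hy, repFun, coeffA_affMk, coeffB_affMk, RCLike.inner_apply, ← mul_assoc]
    filter_upwards [measurePreserving_negExp.quasiMeasurePreserving.ae_eq_comp hz] with s hs
    simp only [Function.comp_apply, mul_negExp (Real.exp_pos c), Real.log_exp] at hs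
    rcases mul_eq_zero.1 hs with h1 | h1
    · exact mul_eq_zero_of_left h1 _
    · exact mul_eq_zero_of_right _ ((map_eq_zero _).1 h1)
  -- integrate over the translations `c` and apply Tonelli's theorem
  have hmeas : ∀ f : HMinus, Measurable (toLine f) := fun f =>
    (Lp.stronglyMeasurable f).measurable.comp continuous_negExp.measurable
  have hf := hmeas f
  have hh := hmeas h
  have h0 : ∫⁻ c, ∫⁻ s, ‖toLine f (s + c)‖ₑ * ‖toLine h s‖ₑ = 0 := by
    have : ∀ c, ∫⁻ s, ‖toLine f (s + c)‖ₑ * ‖toLine h s‖ₑ = 0 := fun c => by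
      rw [lintegral_eq_zero_iff (by fun_prop)]
      filter_upwards [key c] with s hs
      rw [← enorm_mul, hs, enorm_zero, Pi.zero_apply]
    simp [this]
  have hinner : ∀ s, ∫⁻ c, ‖toLine f (s + c)‖ₑ * ‖toLine h s‖ₑ =
      (∫⁻ c, ‖toLine f c‖ₑ) * ‖toLine h s‖ₑ := fun s => by
    rw [lintegral_mul_const _ (by fun_prop), lintegral_add_left_eq_self (fun c => ‖toLine f c‖ₑ) s]
  rw [lintegral_lintegral_swap (by fun_prop)] at h0
  simp only [hinner] at h0
  rw [lintegral_const_mul _ (by fun_prop), mul_eq_zero] at h0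
  have hzero : ∀ f : HMinus, ∫⁻ c, ‖toLine f c‖ₑ = 0 → f = 0 := fun f hf0 => by
    rw [lintegral_eq_zero_iff (hmeas f).enorm] at hf0
    refine toLine_injective ?_
    filter_upwards [hf0, toLine_zero] with s h1 h2
    rw [h2]
    exact enorm_eq_zero.1 h1
  exact h0.imp (hzero f) (hzero h)

instance : Nontrivial HMinus := by
  have hvol : volume (Set.Icc (0 : ℝ) 1) = 1 := by simp
  obtain ⟨f, hf⟩ := exists_toLine_eq (memLp_indicator_const 2 (measurableSet_Icc (a := (0 : ℝ))
    (b := 1)) (1 : ℂ) (Or.inr (by simp)))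
  refine ⟨f, 0, ?_⟩
  rintro rfl
  have h : ∀ᵐ s : ℝ, s ∉ Set.Icc (0 : ℝ) 1 := by
    filter_upwards [hf, toLine_zero] with s h1 h2 hs
    rw [h2, Set.indicator_of_mem hs] at h1
    exact zero_ne_one h1
  have : volume (Set.Icc (0 : ℝ) 1) = 0 := by
    simpa only [ae_iff, not_not, Set.ofPred_mem_eq] using h
  rw [hvol] at this
  exact one_ne_zero this

theorem repMinus_isIrreducible : repMinus.IsIrreducible := by
  refine ⟨inferInstance, fun W hW hinv => ?_⟩
  by_contra! hne
  have : CompleteSpace W := hW.completeSpace_coe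
  obtain ⟨f, hf, hf0⟩ := (Submodule.ne_bot_iff _).1 hne.1
  obtain ⟨h, hh, hh0⟩ := (Submodule.ne_bot_iff Wᗮ).1 fun h =>
    hne.2 (Submodule.orthogonal_eq_bot_iff.1 h)
  rcases repMinus_orthogonal (f := f) (h := h) fun g =>
    Submodule.inner_left_of_mem_orthogonal (hinv g f hf) hh with h | h
  · exact hf0 h
  · exact hh0 h

/-! ### Generators of one-parameter unitary groups -/

section OneParameter

variable {E : Type*} [NormedAddCommGroup E] [InnerProductSpace ℂ E]
  (U : UnitaryRep (Multiplicative ℝ) E)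

/-- The operator `U(t)` of a one-parameter unitary group. -/
def flow (t : ℝ) : E ≃ₗᵢ[ℂ] E := U.act (Multiplicative.ofAdd t)

theorem flow_zero (x : E) : flow U 0 x = x := by
  rw [flow, ofAdd_zero, map_one]
  rfl

theorem flow_add (s t : ℝ) (x : E) : flow U (s + t) x = flow U s (flow U t x) := by
  rw [flow, ofAdd_add, map_mul]
  rfl

theorem flow_comm (s t : ℝ) (x : E) : flow U s (flow U t x) = flow U t (flow U s x) := by
  rw [← flow_add, ← flow_add, add_comm]

variable {U}

theorem mem_generatorGraph {z : E × E} :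
    z ∈ generatorGraph U ↔ HasDerivAt (fun t => flow U t z.1) z.2 0 := Iff.rfl

theorem hasDerivAt_flow {x y : E} (h : (x, y) ∈ generatorGraph U) (t : ℝ) :
    HasDerivAt (fun t => flow U t x) (flow U t y) t := by
  have h0 : HasDerivAt (fun s => flow U s x) y (t - t) := by
    rw [sub_self]
    exact mem_generatorGraph.1 h
  have h1 : HasDerivAt (fun s => flow U (s - t) x) y t := h0.comp_sub_const t t
  have h2 := (((flow U t).toContinuousLinearEquiv : E →L[ℂ] E).restrictScalars
    ℝ).hasFDerivAt.comp_hasDerivAt t h1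
  refine h2.congr_of_eventuallyEq (Eventually.of_forall fun s => ?_)
  change flow U s x = flow U t (flow U (s - t) x)
  rw [← flow_add, add_sub_cancel]

theorem flow_mem_generatorGraph {x y : E} (h : (x, y) ∈ generatorGraph U) (t : ℝ) :
    (flow U t x, flow U t y) ∈ generatorGraph U := by
  have h2 := (((flow U t).toContinuousLinearEquiv : E →L[ℂ] E).restrictScalars
    ℝ).hasFDerivAt.comp_hasDerivAt 0 (mem_generatorGraph.1 h)
  refine mem_generatorGraph.2
    (h2.congr_of_eventuallyEq (Eventually.of_forall fun s => flow_comm U s t x))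

theorem sub_mem_generatorGraph {x y x' y' : E} (h : (x, y) ∈ generatorGraph U)
    (h' : (x', y') ∈ generatorGraph U) : (x - x', y - y') ∈ generatorGraph U := by
  refine mem_generatorGraph.2 ?_
  simpa using (mem_generatorGraph.1 h).fun_sub (mem_generatorGraph.1 h')

theorem generatorGraph_unique {x y y' : E} (h : (x, y) ∈ generatorGraph U)
    (h' : (x, y') ∈ generatorGraph U) : y = y' :=
  (mem_generatorGraph.1 h).unique (mem_generatorGraph.1 h')

theorem isClosed_generatorGraph : IsClosed (generatorGraph U) := by
  refine IsSeqClosed.isClosed fun z w hz hlim => ?_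
  have h := hasDerivAt_of_tendstoUniformly (l := atTop) (f := fun n t => flow U t (z n).1)
    (f' := fun n t => flow U t (z n).2) (g := fun t => flow U t w.1)
    (g' := fun t => flow U t w.2) ?_ (Eventually.of_forall fun n t => hasDerivAt_flow (hz n) t)
    (fun t => ((flow U t).continuous.tendsto _).comp ((continuous_fst.tendsto _).comp hlim)) 0
  · rw [flow_zero] at h
    exact h
  · rw [Metric.tendstoUniformly_iff]
    intro ε hε
    filter_upwards [Metric.tendsto_nhds.1 ((continuous_snd.tendsto _).comp hlim) ε hε] with n hn t
    rw [(flow U t).dist_map, dist_comm]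
    exact hn

/-- The generator is skew-symmetric. -/
theorem inner_generatorGraph {x y x' y' : E} (h : (x, y) ∈ generatorGraph U)
    (h' : (x', y') ∈ generatorGraph U) : inner ℂ x y' + inner ℂ y x' = 0 := by
  have hd := (mem_generatorGraph.1 h).inner ℂ (mem_generatorGraph.1 h')
  simp only [LinearIsometryEquiv.inner_map_map, flow_zero] at hd
  exact hd.unique (hasDerivAt_const _ _)

/-- A one-parameter unitary group is determined by its generator. -/
theorem flow_eq_of_generatorGraph_eq {U' : UnitaryRep (Multiplicative ℝ) E}
    (hU : generatorGraph U = generatorGraph U')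
    (hdense : Dense {x : E | ∃ y, (x, y) ∈ generatorGraph U}) (t : ℝ) : flow U t = flow U' t := by
  have key : ∀ x ∈ {x : E | ∃ y, (x, y) ∈ generatorGraph U}, flow U t x = flow U' t x := by
    rintro x ⟨y, h⟩
    have h' : (x, y) ∈ generatorGraph U' := hU ▸ h
    have hd : ∀ t, HasDerivAt (fun t => flow U t x - flow U' t x)
        (flow U t y - flow U' t y) t := fun t => (hasDerivAt_flow h t).sub (hasDerivAt_flow h' t)
    have hmem : ∀ t, (flow U t x - flow U' t x, flow U t y - flow U' t y) ∈ generatorGraph U :=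
      fun t => sub_mem_generatorGraph (flow_mem_generatorGraph h t)
        (hU ▸ flow_mem_generatorGraph h' t)
    -- by skew-symmetry the norm of the difference of the two orbits is constant
    have hi : ∀ t, HasDerivAt (fun t => inner ℂ (flow U t x - flow U' t x)
        (flow U t x - flow U' t x)) 0 t := fun t =>
      ((hd t).inner ℂ (hd t)).congr_deriv (inner_generatorGraph (hmem t) (hmem t))
    have hc := is_const_of_deriv_eq_zero (fun t => (hi t).differentiableAt)
      (fun t => (hi t).deriv) t 0
    rw [flow_zero, flow_zero, sub_self, inner_zero_left] at hc
    exact sub_eq_zero.1 (inner_self_eq_zero.1 hc)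
  refine LinearIsometryEquiv.ext fun x => ?_
  exact congrFun (Continuous.ext_on hdense (flow U t).continuous (flow U' t).continuous key) x

theorem eq_zero_of_hasDerivAt_self {d : ℝ → ℂ} (hd : ∀ t, HasDerivAt d (d t) t) {M : ℝ}
    (hM : ∀ t, ‖d t‖ ≤ M) : d 0 = 0 := by
  have h : ∀ t : ℝ, HasDerivAt (fun t : ℝ => Real.exp (-t) • d t) 0 t := fun t => by
    refine (((hasDerivAt_neg t).exp).smul (hd t)).congr_deriv ?_
    rw [mul_neg_one, neg_smul, add_neg_cancel]
  have hc : ∀ t : ℝ, Real.exp (-t) • d t = d 0 := fun t => by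
    simpa using is_const_of_deriv_eq_zero (fun t => (h t).differentiableAt)
      (fun t => (h t).deriv) t 0
  have hlim : Tendsto (fun t : ℝ => Real.exp (-t) * M) atTop (𝓝 0) := by
    simpa using Real.tendsto_exp_neg_atTop_nhds_zero.mul_const M
  refine norm_le_zero_iff.1 (ge_of_tendsto' hlim fun t => ?_)
  rw [← hc t, norm_smul, Real.norm_eq_abs, Real.abs_exp]
  exact mul_le_mul_of_nonneg_left (hM t) (Real.exp_pos _).le

/-- The equation `c'' = c` has no nonzero bounded solutions. -/
theorem eq_zero_of_hasDerivAt_hasDerivAt {c c' : ℝ → ℂ} (hc : ∀ t, HasDerivAt c (c' t) t)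
    (hc' : ∀ t, HasDerivAt c' (c t) t) {M M' : ℝ} (hM : ∀ t, ‖c t‖ ≤ M)
    (hM' : ∀ t, ‖c' t‖ ≤ M') : c 0 = 0 := by
  have h1 : c 0 + c' 0 = 0 := eq_zero_of_hasDerivAt_self (d := fun t => c t + c' t)
    (fun t => ((hc t).add (hc' t)).congr_deriv (add_comm _ _))
    (fun t => (norm_add_le _ _).trans (add_le_add (hM t) (hM' t)))
  have h2 : c (-0) - c' (-0) = 0 := eq_zero_of_hasDerivAt_self (d := fun t => c (-t) - c' (-t))
    (fun t => by
      refine (((hc (-t)).scomp t (hasDerivAt_neg t)).sub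
        ((hc' (-t)).scomp t (hasDerivAt_neg t))).congr_deriv ?_
      simp [neg_add_eq_sub])
    (fun t => (norm_sub_le _ _).trans (add_le_add (hM _) (hM' _)))
  rw [neg_zero] at h2
  linear_combination (h1 + h2) / 2

/-- A dense subspace of the domain of the generator that is invariant under the group is a core.
An element `(x, y)` of the graph of the generator that is orthogonal to the graph `Γ` of the
restriction satisfies `c'' = c` for `c(t) = ⟪x, U(t)z⟫`, for all `z` in the subspace. -/
theorem closure_eq_generatorGraph [CompleteSpace E] (Γ : Submodule ℂ (E × E))
    (hΓ : (Γ : Set (E × E)) ⊆ generatorGraph U) (hdense : Dense {x : E | ∃ y, (x, y) ∈ Γ})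
    (hinv : ∀ t x y, (x, y) ∈ Γ → (flow U t x, flow U t y) ∈ Γ) :
    closure (Γ : Set (E × E)) = generatorGraph U := by
  have hcl : closure (Γ : Set (E × E)) ⊆ generatorGraph U :=
    closure_minimal hΓ isClosed_generatorGraph
  refine hcl.antisymm ?_
  rintro ⟨x, y⟩ hxy
  let e := WithLp.prodContinuousLinearEquiv 2 ℂ E E
  let K : Submodule ℂ (WithLp 2 (E × E)) :=
    Γ.topologicalClosure.comap (e : WithLp 2 (E × E) →ₗ[ℂ] E × E)
  have hK : IsClosed (K : Set (WithLp 2 (E × E))) :=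
    Γ.isClosed_topologicalClosure.preimage e.continuous
  have : CompleteSpace K := hK.completeSpace_coe
  obtain ⟨k, hk, w, hw, hkw⟩ := K.exists_add_mem_mem_orthogonal (WithLp.toLp 2 (x, y))
  have hkΓ : (k.fst, k.snd) ∈ closure (Γ : Set (E × E)) := hk
  have hwg : (w.fst, w.snd) ∈ generatorGraph U := by
    have h := sub_mem_generatorGraph hxy (hcl hkΓ)
    have h1 := congrArg WithLp.fst hkw
    have h2 := congrArg WithLp.snd hkw
    simp only [WithLp.add_fst, WithLp.add_snd] at h1 h2
    change x = _ at h1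
    change y = _ at h2
    rwa [h1, h2, add_sub_cancel_left, add_sub_cancel_left] at h
  have horth : ∀ z v, (z, v) ∈ Γ → inner ℂ w.fst z + inner ℂ w.snd v = 0 := by
    intro z v hzv
    have hm : WithLp.toLp 2 (z, v) ∈ K := subset_closure hzv
    exact Submodule.inner_left_of_mem_orthogonal hm hw
  have hzero : ∀ z ∈ {z : E | ∃ v, (z, v) ∈ Γ}, inner ℂ w.fst z = 0 := by
    rintro z ⟨v, hzv⟩
    have hd := hasDerivAt_flow (hΓ hzv)
    have hc := eq_zero_of_hasDerivAt_hasDerivAt (c := fun t => inner ℂ w.fst (flow U t z))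
      (c' := fun t => -inner ℂ w.snd (flow U t z)) (M := ‖w.fst‖ * ‖z‖) (M' := ‖w.snd‖ * ‖z‖)
      (fun t => by
        refine ((hasDerivAt_const t w.fst).inner ℂ (hd t)).congr_deriv ?_
        rw [inner_zero_left, add_zero, eq_neg_iff_add_eq_zero]
        exact inner_generatorGraph hwg (flow_mem_generatorGraph (hΓ hzv) t))
      (fun t => by
        refine ((hasDerivAt_const t w.snd).inner ℂ (hd t)).neg.congr_deriv ?_
        rw [inner_zero_left, add_zero, neg_eq_iff_add_eq_zero, add_comm]
        exact horth _ _ (hinv t z v hzv))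
      (fun t => by simpa using norm_inner_le_norm (𝕜 := ℂ) w.fst (flow U t z))
      (fun t => by simpa using norm_inner_le_norm (𝕜 := ℂ) w.snd (flow U t z))
    simpa only [flow_zero] using hc
  have hw1 : w.fst = 0 := by
    have h := Continuous.ext_on hdense (f := fun z => inner ℂ w.fst z) (g := fun _ => (0 : ℂ))
      (by fun_prop) continuous_const hzero
    exact inner_self_eq_zero.1 (congrFun h w.fst)
  have hw2 : w.snd = 0 := by
    rw [hw1] at hwg
    have h := mem_generatorGraph.1 hwg
    simp only [map_zero] at h
    exact h.unique (hasDerivAt_const _ _)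
  have hx : (x, y) = (k.fst, k.snd) := by
    have h1 := congrArg WithLp.fst hkw
    have h2 := congrArg WithLp.snd hkw
    simp only [WithLp.add_fst, WithLp.add_snd, hw1, hw2, add_zero] at h1 h2
    exact Prod.ext h1 h2
  rw [hx]
  exact hkΓ

end OneParameter

/-! ### The one-parameter groups `T(exp τZ)` and their generators -/

/-- The one-parameter unitary group `τ ↦ T(exp τZ)`. -/
noncomputable def oneParam (Z : aff) : UnitaryRep (Multiplicative ℝ) HMinus where
  act :=
    { toFun := fun t => repMinus.act (expG (t.toAdd • Z))
      map_one' := by rw [toAdd_one, zero_smul, expG_zero, map_one]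
      map_mul' := fun s t => by rw [toAdd_mul, expG_add_smul, map_mul] }
  continuous_act f := by
    have hc : Continuous fun t : ℝ => expG (t • Z) := by
      refine continuous_aff0 ?_ (continuous_iff_continuousAt.2 fun t =>
        (hasDerivAt_coeffB_expG_smul Z t).continuousAt)
      simp only [coeffA_expG_smul]
      fun_prop
    exact (repMinus.continuous_act f).comp (hc.comp continuous_toAdd)

theorem flow_oneParam (Z : aff) (t : ℝ) (f : HMinus) :
    flow (oneParam Z) t f = repIsometry (expG (t • Z)) f := rfl

/-- The function `s ↦ e^{-i b(t) e^s} ψ(s + αt)`, which represents `T(exp tZ)f` in the logarithmic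
coordinate if `ψ` represents `f`. -/
noncomputable def lineFlow (Z : aff) (ψ : ℝ → ℂ) (t s : ℝ) : ℂ :=
  Complex.exp (Complex.I * coeffB (expG (t • Z)) * negExp s) * ψ (s + Z.val 0 0 * t)

theorem toLine_flow_oneParam (Z : aff) (t : ℝ) {f : HMinus} {ψ : ℝ → ℂ}
    (hf : toLine f =ᵐ[volume] ψ) :
    toLine (flow (oneParam Z) t f) =ᵐ[volume] lineFlow Z ψ t := by
  filter_upwards [toLine_repIsometry_of_ae_eq (expG (t • Z)) hf] with s hs
  rw [flow_oneParam, hs, lineFlow, coeffA_expG_smul, Real.log_exp]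

theorem IsTestLine.hasDerivAt {ψ : ℝ → ℂ} (hψ : IsTestLine ψ) (s : ℝ) :
    HasDerivAt ψ (deriv ψ s) s :=
  (hψ.1.differentiable (by simp) s).hasDerivAt

theorem IsTestLine.deriv {ψ : ℝ → ℂ} (hψ : IsTestLine ψ) : IsTestLine (deriv ψ) :=
  ⟨(contDiff_infty_iff_deriv.1 hψ.1).2, hψ.2.deriv⟩

theorem contDiff_ofReal_negExp : ContDiff ℝ ∞ fun s => (negExp s : ℂ) :=
  Complex.ofRealCLM.contDiff.comp Real.contDiff_exp.neg

theorem IsTestLine.lineFlow {ψ : ℝ → ℂ} (hψ : IsTestLine ψ) (Z : aff) (t : ℝ) :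
    IsTestLine (lineFlow Z ψ t) := by
  refine ⟨(contDiff_const.mul contDiff_ofReal_negExp).cexp.mul
    (hψ.1.comp (contDiff_id.add contDiff_const)), HasCompactSupport.mul_left ?_⟩
  exact hψ.2.comp_homeomorph (Homeomorph.addRight (Z.val 0 0 * t))

/-- The operator `α ∂_s - i β e^s`, which is `ℓ̂_Z = α y ∂_y + i β y` in the logarithmic
coordinate. -/
noncomputable def lineOp (Z : aff) (ψ : ℝ → ℂ) (s : ℝ) : ℂ :=
  Z.val 0 0 * deriv ψ s + Complex.I * Z.val 0 1 * negExp s * ψ s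

theorem IsTestLine.lineOp {ψ : ℝ → ℂ} (hψ : IsTestLine ψ) (Z : aff) : IsTestLine (lineOp Z ψ) :=
  ⟨(contDiff_const.mul hψ.deriv.1).add ((contDiff_const.mul contDiff_ofReal_negExp).mul hψ.1),
    (hψ.deriv.2.mul_left).add hψ.2.mul_left⟩

/-- The derivative of `lineFlow` with respect to `t`. -/
noncomputable def lineFlowDeriv (Z : aff) (ψ : ℝ → ℂ) (t s : ℝ) : ℂ :=
  Complex.exp (Complex.I * coeffB (expG (t • Z)) * negExp s) *
    (Z.val 0 0 * deriv ψ (s + Z.val 0 0 * t) +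
      Complex.I * (Z.val 0 1 * Real.exp (Z.val 0 0 * t) : ℝ) * negExp s *
        ψ (s + Z.val 0 0 * t))

theorem hasDerivAt_lineFlow {ψ : ℝ → ℂ} (hψ : IsTestLine ψ) (Z : aff) (t s : ℝ) :
    HasDerivAt (fun t => lineFlow Z ψ t s) (lineFlowDeriv Z ψ t s) t := by
  have h1 : HasDerivAt (fun t : ℝ => s + Z.val 0 0 * t) (Z.val 0 0) t := by
    simpa using ((hasDerivAt_id t).const_mul (Z.val 0 0)).const_add s
  have h2 := (hψ.hasDerivAt (s + Z.val 0 0 * t)).scomp t h1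
  have h3 := (((hasDerivAt_coeffB_expG_smul Z t).ofReal_comp.const_mul Complex.I).mul_const
    (negExp s : ℂ)).cexp
  refine (h3.mul h2).congr_deriv ?_
  simp only [lineFlowDeriv, Function.comp_apply, Complex.real_smul]
  ring

theorem lineFlow_zero (Z : aff) (ψ : ℝ → ℂ) (s : ℝ) : lineFlow Z ψ 0 s = ψ s := by
  simp [lineFlow, expG_zero]

theorem lineFlowDeriv_zero (Z : aff) (ψ : ℝ → ℂ) (s : ℝ) :
    lineFlowDeriv Z ψ 0 s = lineOp Z ψ s := by
  simp [lineFlowDeriv, lineOp, expG_zero]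

theorem continuous_lineFlowDeriv {ψ : ℝ → ℂ} (hψ : IsTestLine ψ) (Z : aff) :
    Continuous (Function.uncurry (lineFlowDeriv Z ψ)) := by
  have h1 : Continuous fun t : ℝ => coeffB (expG (t • Z)) := continuous_iff_continuousAt.2
    fun t => (hasDerivAt_coeffB_expG_smul Z t).continuousAt
  have h2 := hψ.1.continuous
  have h3 := hψ.deriv.1.continuous
  have h4 : Continuous fun x : ℝ × ℝ => coeffB (expG (x.1 • Z)) := h1.comp continuous_fst
  unfold lineFlowDeriv Function.uncurry
  fun_prop

/-- The difference quotients converge in `L²`: for `|t| ≤ 1` they vanish outside a fixed compact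
set, and they are bounded by the mean value inequality. -/
theorem tendsto_slope_lineFlow {ψ : ℝ → ℂ} (hψ : IsTestLine ψ) (Z : aff) :
    Tendsto (fun t : ℝ => eLpNorm (fun s => (t⁻¹ : ℝ) * (lineFlow Z ψ t s - ψ s) - lineOp Z ψ s)
      2 volume) (𝓝[≠] 0) (𝓝 0) := by
  obtain ⟨R, hR⟩ := exists_bound_support hψ.2
  have hK : IsCompact (Set.Icc (-(R + |Z.val 0 0|)) (R + |Z.val 0 0|)) := isCompact_Icc
  obtain ⟨C, hC⟩ := ((isCompact_Icc (a := (-1 : ℝ)) (b := 1)).prod hK).exists_bound_of_continuousOn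
    (continuous_lineFlowDeriv hψ Z).continuousOn
  replace hC := fun x hx => (hC x hx).trans (le_abs_self C)
  have hnear : ∀ᶠ t : ℝ in 𝓝[≠] 0, t ∈ Set.Icc (-1 : ℝ) 1 ∧ t ≠ 0 :=
    (eventually_nhdsWithin_of_eventually_nhds (Icc_mem_nhds (by norm_num) (by norm_num))).and
      self_mem_nhdsWithin
  have hout : ∀ t ∈ Set.Icc (-1 : ℝ) 1, ∀ s ∉ Set.Icc (-(R + |Z.val 0 0|)) (R + |Z.val 0 0|),
      ψ (s + Z.val 0 0 * t) = 0 := by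
    intro t ht s hs
    have hs : R + |Z.val 0 0| < |s| := by
      by_contra h
      exact hs (abs_le.1 (not_lt.1 h))
    have h1 : |s| ≤ |s + Z.val 0 0 * t| + |Z.val 0 0 * t| := by
      simpa using abs_sub (s + Z.val 0 0 * t) (Z.val 0 0 * t)
    have h2 : |Z.val 0 0 * t| ≤ |Z.val 0 0| := by
      rw [abs_mul]
      exact mul_le_of_le_one_right (abs_nonneg _) (abs_le.2 ht)
    exact hR _ (by linarith)
  have h0mem : (0 : ℝ) ∈ Set.Icc (-1 : ℝ) 1 := by simp
  have hψ0 : ∀ s ∉ Set.Icc (-(R + |Z.val 0 0|)) (R + |Z.val 0 0|), ψ s = 0 := fun s hs => by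
    simpa using hout 0 h0mem s hs
  have hop0 : ∀ s ∉ Set.Icc (-(R + |Z.val 0 0|)) (R + |Z.val 0 0|), lineOp Z ψ s = 0 := by
    intro s hs
    have hev : ψ =ᶠ[𝓝 s] fun _ => 0 := by
      filter_upwards [isClosed_Icc.isOpen_compl.mem_nhds hs] with r hr using hψ0 r hr
    rw [lineOp, hev.deriv_eq, hψ0 s hs]
    simp
  refine tendsto_eLpNorm_zero hK (|C| + |C|) ?_ ?_ ?_ ?_
  · refine Eventually.of_forall fun t => Continuous.aestronglyMeasurable ?_
    exact (continuous_const.mul ((hψ.lineFlow Z t).1.continuous.sub hψ.1.continuous)).sub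
      (hψ.lineOp Z).1.continuous
  · filter_upwards [hnear] with t ht s
    by_cases hs : s ∈ Set.Icc (-(R + |Z.val 0 0|)) (R + |Z.val 0 0|)
    · refine (norm_sub_le _ _).trans (add_le_add ?_ ?_)
      · have h := (convex_Icc (-1 : ℝ) 1).norm_image_sub_le_of_norm_hasDerivWithin_le
          (fun r _ => (hasDerivAt_lineFlow hψ Z r s).hasDerivWithinAt)
          (fun r hr => hC (r, s) ⟨hr, hs⟩) h0mem ht.1
        rw [lineFlow_zero, sub_zero] at h
        rw [norm_mul, Complex.norm_real, norm_inv, inv_mul_le_iff₀ (norm_pos_iff.2 ht.2), mul_comm]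
        exact h
      · rw [← lineFlowDeriv_zero]
        exact hC (0, s) ⟨h0mem, hs⟩
    · rw [lineFlow, hout t ht.1 s hs, hψ0 s hs, hop0 s hs]
      simp
  · filter_upwards [hnear] with t ht s hs
    rw [lineFlow, hout t ht.1 s hs, hψ0 s hs, hop0 s hs]
    simp
  · intro s
    have h := hasDerivAt_iff_tendsto_slope_zero.1 (hasDerivAt_lineFlow hψ Z 0 s)
    rw [lineFlowDeriv_zero] at h
    simp only [zero_add, lineFlow_zero, Complex.real_smul] at h
    simpa using h.sub_const (lineOp Z ψ s)

theorem mem_generatorGraph_oneParam {ψ : ℝ → ℂ} (hψ : IsTestLine ψ) (Z : aff) {f g : HMinus}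
    (hf : toLine f =ᵐ[volume] ψ) (hg : toLine g =ᵐ[volume] lineOp Z ψ) :
    (f, g) ∈ generatorGraph (oneParam Z) := by
  refine mem_generatorGraph.2 (hasDerivAt_iff_tendsto_slope_zero.2 ?_)
  rw [tendsto_iff_edist_tendsto_0]
  refine (tendsto_slope_lineFlow hψ Z).congr fun t => ?_
  rw [zero_add, flow_zero, edist_eq_toLine]
  refine eLpNorm_congr_ae ?_
  have hsmul : toLine (t⁻¹ • (flow (oneParam Z) t f - f)) =ᵐ[volume]
      fun s => (t⁻¹ : ℝ) * toLine (flow (oneParam Z) t f - f) s := by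
    filter_upwards [ae_eq_iff_toLine.1 (Lp.coeFn_smul t⁻¹ (flow (oneParam Z) t f - f))] with s hs
    rw [hs, Pi.smul_apply, Complex.real_smul, toLine]
  filter_upwards [hf, hg, hsmul, toLine_sub (flow (oneParam Z) t f) f,
    toLine_flow_oneParam Z t hf] with s h1 h2 h3 h4 h5
  rw [h3, h4, h5, h1, h2]

/-- The graph of `α ∂_s - i β e^s` on the test functions of the logarithmic coordinate. -/
def lineGraph (Z : aff) : Submodule ℂ (HMinus × HMinus) where
  carrier := {z | ∃ ψ, IsTestLine ψ ∧ toLine z.1 =ᵐ[volume] ψ ∧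
    toLine z.2 =ᵐ[volume] lineOp Z ψ}
  add_mem' := by
    rintro z w ⟨ψ, hψ, h1, h2⟩ ⟨φ, hφ, k1, k2⟩
    refine ⟨fun s => ψ s + φ s, ⟨hψ.1.add hφ.1, hψ.2.add hφ.2⟩, ?_, ?_⟩
    · filter_upwards [h1, k1, toLine_add z.1 w.1] with s e1 e2 e3
      rw [Prod.fst_add, e3, e1, e2]
    · filter_upwards [h2, k2, toLine_add z.2 w.2] with s e1 e2 e3
      rw [Prod.snd_add, e3, e1, e2, lineOp, lineOp, lineOp,
        ((hψ.hasDerivAt s).fun_add (hφ.hasDerivAt s)).deriv]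
      ring
  zero_mem' := by
    refine ⟨fun _ => 0, ⟨contDiff_const, HasCompactSupport.zero⟩, toLine_zero, ?_⟩
    filter_upwards [toLine_zero] with s e
    rw [Prod.snd_zero, e, lineOp]
    simp
  smul_mem' := by
    rintro c z ⟨ψ, hψ, h1, h2⟩
    refine ⟨fun s => c * ψ s, ⟨contDiff_const.mul hψ.1, hψ.2.mul_left⟩, ?_, ?_⟩
    · filter_upwards [h1, toLine_smul c z.1] with s e1 e2
      rw [Prod.smul_fst, e2, e1]
    · filter_upwards [h2, toLine_smul c z.2] with s e1 e2
      rw [Prod.smul_snd, e2, e1, lineOp, lineOp, ((hψ.hasDerivAt s).const_mul c).deriv]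
      ring

theorem lineGraph_subset (Z : aff) :
    (lineGraph Z : Set (HMinus × HMinus)) ⊆ generatorGraph (oneParam Z) := by
  rintro ⟨f, g⟩ ⟨ψ, hψ, hf, hg⟩
  exact mem_generatorGraph_oneParam hψ Z hf hg

theorem dense_domain_lineGraph (Z : aff) : Dense {f | ∃ g, (f, g) ∈ lineGraph Z} := by
  refine dense_testVectors.mono ?_
  rintro f ⟨ψ, hψ, hf⟩
  obtain ⟨g, hg⟩ := (hψ.lineOp Z).exists_toLine_eq
  exact ⟨g, ψ, hψ, hf, hg⟩

theorem closure_lineGraph (Z : aff) :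
    closure (lineGraph Z : Set (HMinus × HMinus)) = generatorGraph (oneParam Z) := by
  refine closure_eq_generatorGraph _ (lineGraph_subset Z) (dense_domain_lineGraph Z) ?_
  -- the generator maps `U(t)f` to `U(t)g`, but also to the test vector given by `lineOp`
  rintro t f g ⟨ψ, hψ, hf, hg⟩
  have hft := toLine_flow_oneParam Z t hf
  obtain ⟨g', hg'⟩ := ((hψ.lineFlow Z t).lineOp Z).exists_toLine_eq
  have h1 := mem_generatorGraph_oneParam (hψ.lineFlow Z t) Z hft hg'
  have h2 := flow_mem_generatorGraph (mem_generatorGraph_oneParam hψ Z hf hg) t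
  rw [generatorGraph_unique h2 h1]
  exact ⟨_, hψ.lineFlow Z t, hft, hg'⟩

/-! ### The operator `ℓ̂_Z` in the logarithmic coordinate -/

/-- The function `s ↦ u(x, q)` with `s = q - x/2`, for a fixed value of `t = q + x/2`. -/
noncomputable def lineSlice (u : ℝ × ℝ → ℂ) (t s : ℝ) : ℂ := u (t - s, (s + t) / 2)

theorem slice_negExp (u : ℝ × ℝ → ℂ) (t s : ℝ) : slice u t (negExp s) = lineSlice u t s := by
  rw [slice, log_neg_negExp, lineSlice]

theorem IsTest.lineSlice (hu : IsTest u) (t : ℝ) : IsTestLine (lineSlice u t) := by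
  refine ⟨hu.1.comp (by fun_prop), ?_⟩
  obtain ⟨K, hK, h0⟩ := hu.exists_compact
  refine HasCompactSupport.intro (hK.image (f := fun x => t - x) (by fun_prop)) fun s hs => ?_
  exact h0 _ _ fun h => hs ⟨t - s, h, by ring⟩

theorem IsTest.lineSlice_ellHat (hu : IsTest u) (Z : aff) (t s : ℝ) :
    AffPlane.lineSlice (ellHat Z u) t s = lineOp Z (AffPlane.lineSlice u t) s := by
  have hpath : HasDerivAt (fun s : ℝ => (t - s, (s + t) / 2)) ((-1 : ℝ), (1 / 2 : ℝ)) s := by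
    refine HasDerivAt.prodMk ?_ ?_
    · simpa using (hasDerivAt_id s).const_sub t
    · simpa using ((hasDerivAt_id s).add_const t).div_const 2
  have hd := (hu.differentiable (t - s, (s + t) / 2)).hasFDerivAt.comp_hasDerivAt s hpath
  have hsplit : ((-1 : ℝ), (1 / 2 : ℝ)) = (-1 : ℝ) • ((1 : ℝ), (0 : ℝ)) +
    (1 / 2 : ℝ) • ((0 : ℝ), (1 : ℝ)) := by simp
  rw [hsplit, map_add, map_smul, map_smul] at hd
  have hderiv : deriv (AffPlane.lineSlice u t) s =
      -pderiv 0 u (t - s, (s + t) / 2) + 1 / 2 * pderiv 1 u (t - s, (s + t) / 2) := by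
    rw [hu.pderiv_fst_eq, hu.pderiv_snd_eq]
    refine hd.deriv.trans ?_
    simp
  have hexp : (Real.exp ((s + t) / 2) : ℂ) * Complex.exp (-((t - s : ℝ) : ℂ) / 2) =
      Real.exp s := by
    rw [Complex.ofReal_exp, Complex.ofReal_exp, ← Complex.exp_add]
    congr 1
    push_cast
    ring
  rw [hu.ellHat_eq, AffPlane.lineSlice, lineOp, hderiv, AffPlane.ellHatFormula, AffPlane.lineSlice,
    negExp]
  push_cast at hexp ⊢
  linear_combination (-(Complex.I * Z.val 0 1) * u (t - s, (s + t) / 2)) * hexp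

/-- Every test function of `s` is a slice of a test function on the plane. -/
theorem IsTestLine.exists_lineSlice_eq {ψ : ℝ → ℂ} (hψ : IsTestLine ψ) :
    ∃ u, IsTest u ∧ lineSlice u 0 = ψ := by
  let χ : ContDiffBump (0 : ℝ) := default
  refine ⟨fun w => ψ (w.2 - w.1 / 2) * (χ (w.2 + w.1 / 2) : ℝ), ⟨?_, ?_⟩, ?_⟩
  · refine ContDiff.mul (hψ.1.comp (by fun_prop)) (Complex.ofRealCLM.contDiff.comp ?_)
    exact χ.contDiff.comp (by fun_prop)
  · refine HasCompactSupport.intro ((hψ.2.isCompact.prod χ.hasCompactSupport.isCompact).image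
      (f := fun x : ℝ × ℝ => (x.2 - x.1, (x.1 + x.2) / 2)) (by fun_prop)) fun w hw => ?_
    by_contra hne
    obtain ⟨h1, h2⟩ := mul_ne_zero_iff.1 hne
    refine hw ⟨(w.2 - w.1 / 2, w.2 + w.1 / 2), ⟨subset_tsupport _ h1, subset_tsupport _ ?_⟩, ?_⟩
    · simpa using h2
    · ext <;> simp
  · funext s
    have h1 : χ 0 = 1 := χ.one_of_mem_closedBall (by simp [χ.rIn_pos.le])
    have e1 : (s + 0) / 2 - (0 - s) / 2 = s := by ring
    have e2 : (s + 0) / 2 + (0 - s) / 2 = 0 := by ring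
    simp only [lineSlice, e1, e2, h1]
    simp

theorem ellHatGraph_eq (Z : aff) : ellHatGraph Z = lineGraph Z := by
  ext ⟨f, g⟩
  constructor
  · rintro ⟨u, hu, t, hf, hg⟩
    rw [ae_eq_iff_toLine] at hf hg
    simp only [slice_negExp, hu.lineSlice_ellHat] at hf hg
    exact ⟨lineSlice u t, hu.lineSlice t, hf, hg⟩
  · rintro ⟨ψ, hψ, hf, hg⟩
    obtain ⟨u, hu, rfl⟩ := hψ.exists_lineSlice_eq
    refine ⟨u, hu, 0, ?_, ?_⟩
    · rw [ae_eq_iff_toLine]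
      simpa only [slice_negExp] using hf
    · rw [ae_eq_iff_toLine]
      simpa only [slice_negExp, hu.lineSlice_ellHat] using hg

theorem isExpOf_ellHatGraph (Z : aff) (V : HMinus ≃ₗᵢ[ℂ] HMinus) :
    IsExpOf (ellHatGraph Z) V ↔ V = repMinus.act (expG Z) := by
  rw [ellHatGraph_eq, IsExpOf, closure_lineGraph]
  have hone : flow (oneParam Z) 1 = repMinus.act (expG Z) := by
    refine LinearIsometryEquiv.ext fun f => ?_
    rw [flow_oneParam, one_smul]
    rfl
  constructor
  · rintro ⟨U, hU, rfl⟩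
    rw [← hone]
    refine flow_eq_of_generatorGraph_eq hU ?_ 1
    rw [hU]
    exact (dense_domain_lineGraph Z).mono fun f hf =>
      hf.imp fun g hg => lineGraph_subset Z hg
  · rintro rfl
    exact ⟨oneParam Z, rfl, hone⟩

/-! ### The representations induced from the subgroup of translations -/

theorem enorm_sq_eq_lintegral_toLine (f : HMinus) : ‖f‖ₑ ^ 2 = ∫⁻ s, ‖toLine f s‖ₑ ^ 2 := by
  rw [Lp.enorm_def, ← eLpNorm_comp_measurePreserving (Lp.aestronglyMeasurable f)
    measurePreserving_negExp, eLpNorm_eq_lintegral_rpow_enorm_toReal (by simp) (by simp),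
    ← ENNReal.rpow_natCast, ← ENNReal.rpow_mul]
  simp [toLine]

/-- The element of `L²((-∞, 0), dy/|y|)` given by an `L²` function of `s = log (-y)`. -/
noncomputable def ofLine (ψ : ℝ → ℂ) (hψ : MemLp ψ 2 volume) : HMinus :=
  (exists_toLine_eq hψ).choose

theorem toLine_ofLine {ψ : ℝ → ℂ} (hψ : MemLp ψ 2 volume) :
    toLine (ofLine ψ hψ) =ᵐ[volume] ψ :=
  (exists_toLine_eq hψ).choose_spec

variable {H : Subgroup Aff0}

theorem mk_eq_mk_iff (hH : ∀ g, g ∈ H ↔ coeffA g = 1)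
    (x y : Aff0) : (x : Aff0 ⧸ H) = y ↔ coeffA x = coeffA y := by
  rw [QuotientGroup.eq, hH, coeffA_mul, coeffA_inv, inv_mul_eq_one₀ (coeffA_pos x).ne']

/-- The diagonal element `(c e^{-s} 0; 0 1)`. The value at `s` of the image in
`L²((-∞, 0), dy/|y|)` of a section of the induced representation, in the logarithmic coordinate,
is its value at this element. -/
noncomputable def diag (c s : ℝ) : Aff0 := affMk (Real.exp (Real.log c - s)) 0 (Real.exp_pos _)

theorem continuous_diag (c : ℝ) : Continuous (diag c) := by
  refine continuous_aff0 ?_ continuous_const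
  simp only [diag, coeffA_affMk]
  fun_prop

/-- The homeomorphism `s ↦ (c e^{-s} 0; 0 1) H` of the line with the homogeneous space. -/
noncomputable def quotientHomeomorph (hH : ∀ g, g ∈ H ↔ coeffA g = 1)
    (c : ℝ) : ℝ ≃ₜ Aff0 ⧸ H where
  toFun s := diag c s
  invFun := Quotient.lift (fun g : Aff0 => Real.log c - Real.log (coeffA g)) fun x y hxy => by
    have h : (x : Aff0 ⧸ H) = y := Quotient.sound hxy
    simp only [(mk_eq_mk_iff hH x y).1 h]
  left_inv s := by
    change Real.log c - Real.log (coeffA (diag c s)) = s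
    rw [diag, coeffA_affMk, Real.log_exp, sub_sub_cancel]
  right_inv z := by
    induction z using QuotientGroup.induction_on with
    | H g =>
      refine (mk_eq_mk_iff hH _ _).2 ?_
      change coeffA (diag c (Real.log c - Real.log (coeffA g))) = _
      rw [diag, coeffA_affMk, sub_sub_cancel, Real.exp_log (coeffA_pos g)]
  continuous_toFun := QuotientGroup.continuous_mk.comp (continuous_diag c)
  continuous_invFun := Continuous.quotient_lift (by
    have hc : Continuous fun g => Real.log (coeffA g) :=
      continuous_coeffA.log fun g => (coeffA_pos g).ne'
    fun_prop) _

theorem quotientHomeomorph_apply (hH : ∀ g, g ∈ H ↔ coeffA g = 1)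
    (c s : ℝ) :
    quotientHomeomorph hH c s = ((diag c s : Aff0) : Aff0 ⧸ H) := rfl

theorem mk_eq_quotientHomeomorph (hH : ∀ g, g ∈ H ↔ coeffA g = 1)
    (c : ℝ) (g : Aff0) : (g : Aff0 ⧸ H) =
    quotientHomeomorph hH c (Real.log c - Real.log (coeffA g)) := by
  rw [quotientHomeomorph_apply, mk_eq_mk_iff hH, diag, coeffA_affMk, sub_sub_cancel,
    Real.exp_log (coeffA_pos g)]

variable {χ : H →* Circle}

theorem norm_section_out (Φ : inducedSections H χ) (g : Aff0) :
    ‖Φ.val (g : Aff0 ⧸ H).out‖ₑ = ‖Φ.val g‖ₑ := by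
  obtain ⟨h, hh⟩ := QuotientGroup.mk_out_eq_mul H g
  rw [hh, Φ.property.2.1, enorm_mul]
  have h1 : ‖(((χ h)⁻¹ : Circle) : ℂ)‖ₑ = 1 := by
    rw [← ofReal_norm, Circle.norm_coe, ENNReal.ofReal_one]
  rw [h1, one_mul]

theorem memLp_section (hH : ∀ g, g ∈ H ↔ coeffA g = 1)
    (c : ℝ) (Φ : inducedSections H χ) :
    MemLp (fun s => Φ.val (diag c s)) 2 volume := by
  obtain ⟨hc, -, K, hK, h0⟩ := Φ.property
  refine Continuous.memLp_of_hasCompactSupport (hc.comp (continuous_diag c)) ?_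
  refine HasCompactSupport.intro
    ((quotientHomeomorph hH c).isCompact_preimage.2 hK) fun s hs => h0 _ hs

/-- The map `(JΦ)(y) = Φ(-c/y 0; 0 1)` from the sections to `L²((-∞, 0), dy/|y|)`. -/
noncomputable def inducedMap (hH : ∀ g, g ∈ H ↔ coeffA g = 1)
    (χ : H →* Circle) (c : ℝ) : inducedSections H χ →ₗ[ℂ] HMinus where
  toFun Φ := ofLine _ (memLp_section hH c Φ)
  map_add' Φ Ψ := by
    refine toLine_injective ?_
    filter_upwards [toLine_ofLine (memLp_section hH c (Φ + Ψ)),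
      toLine_ofLine (memLp_section hH c Φ), toLine_ofLine (memLp_section hH c Ψ),
      toLine_add (ofLine _ (memLp_section hH c Φ)) (ofLine _ (memLp_section hH c Ψ))]
      with s h1 h2 h3 h4
    rw [h1, h4, h2, h3]
    rfl
  map_smul' k Φ := by
    refine toLine_injective ?_
    filter_upwards [toLine_ofLine (memLp_section hH c (k • Φ)),
      toLine_ofLine (memLp_section hH c Φ),
      toLine_smul k (ofLine _ (memLp_section hH c Φ))] with s h1 h2 h3
    rw [h1, RingHom.id_apply, h3, h2]
    rfl

theorem toLine_inducedMap (hH : ∀ g, g ∈ H ↔ coeffA g = 1)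
    (c : ℝ) (Φ : inducedSections H χ) :
    toLine (inducedMap hH χ c Φ) =ᵐ[volume] fun s => Φ.val (diag c s) :=
  toLine_ofLine (memLp_section hH c Φ)

theorem inducedMap_equivariant (hH : ∀ g, g ∈ H ↔ coeffA g = 1)
    {c : ℝ} (hc : 0 < c)
    (hχ : ∀ h : H, χ h = Circle.exp (-(c * coeffB h))) (g : Aff0) (Φ Ψ : inducedSections H χ)
    (h : ∀ x, Ψ.val x = Φ.val (g⁻¹ * x)) :
    inducedMap hH χ c Ψ = repMinus.act g (inducedMap hH χ c Φ) := by
  rw [repMinus_act]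
  refine toLine_injective ?_
  filter_upwards [toLine_inducedMap hH c Ψ,
    toLine_repIsometry_of_ae_eq g (toLine_inducedMap hH c Φ)] with s h1 h2
  have hg := coeffA_pos g
  -- factor `g⁻¹ (A 0; 0 1)` as a diagonal element times an element of `H`
  let k : H := ⟨affMk 1 (-(coeffB g / Real.exp (Real.log c - s))) one_pos,
    (hH _).2 (coeffA_affMk _ _ _)⟩
  have hfac : g⁻¹ * diag c s = diag c (s + Real.log (coeffA g)) * k := by
    have e : Real.exp (Real.log c - (s + Real.log (coeffA g))) =
        Real.exp (Real.log c - s) / coeffA g := by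
      rw [← sub_sub, Real.exp_sub (Real.log c - s), Real.exp_log hg]
    have hne := (Real.exp_pos (Real.log c - s)).ne'
    apply Aff0.ext
    · simp only [coeffA_mul, coeffA_inv, diag, coeffA_affMk, k, e]
      field_simp
    · simp only [coeffB_mul, coeffB_inv, coeffA_inv, diag, coeffA_affMk, coeffB_affMk, k, e]
      field_simp
      ring
  rw [h1, h2, h, hfac, Φ.property.2.1, hχ, ← Circle.exp_neg, Circle.coe_exp]
  congr 2
  have e : Real.exp (Real.log c - s) = c / Real.exp s := by rw [Real.exp_sub, Real.exp_log hc]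
  have hk : -(-(c * coeffB (k : Aff0))) = coeffB g * negExp s := by
    simp only [k, coeffB_affMk, e, negExp]
    field_simp
  rw [hk]
  push_cast
  ring

theorem denseRange_inducedMap (hH : ∀ g, g ∈ H ↔ coeffA g = 1)
    {c : ℝ} (hχ : ∀ h : H, χ h = Circle.exp (-(c * coeffB h))) :
    DenseRange (inducedMap hH χ c) := by
  refine dense_testVectors.mono ?_
  rintro f ⟨ψ, hψ, hf⟩
  -- the section that extends `ψ` from the diagonal elements
  let Φ : Aff0 → ℂ := fun g => Circle.exp (c * (coeffB g / coeffA g)) *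
    ψ (Real.log c - Real.log (coeffA g))
  have hA : ∀ g, coeffA g ≠ 0 := fun g => (coeffA_pos g).ne'
  have hΦ : Φ ∈ inducedSections H χ := by
    refine ⟨?_, fun x h => ?_, quotientHomeomorph hH c '' tsupport ψ,
      hψ.2.isCompact.image (quotientHomeomorph hH c).continuous, fun x hx => ?_⟩
    · have h1 : Continuous fun g => Real.log (coeffA g) := continuous_coeffA.log hA
      have h2 : Continuous fun g => coeffB g / coeffA g :=
        continuous_coeffB.div continuous_coeffA hA
      have h3 := hψ.1.continuous
      have h4 : Continuous fun g => Circle.exp (c * (coeffB g / coeffA g)) :=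
        Circle.exp.continuous.comp (continuous_const.mul h2)
      exact (continuous_subtype_val.comp h4).mul (h3.comp (continuous_const.sub h1))
    · have hh : coeffA h = 1 := (hH h).1 h.property
      have hx := hA x
      simp only [Φ]
      rw [hχ, ← Circle.exp_neg, coeffA_mul, coeffB_mul, hh, mul_one, ← mul_assoc,
        ← Circle.coe_mul, ← Circle.exp_add]
      congr 3
      field_simp
    · have h0 : ψ (Real.log c - Real.log (coeffA x)) = 0 := by
        by_contra hne
        exact hx ⟨_, subset_tsupport ψ hne, (mk_eq_quotientHomeomorph hH c x).symm⟩
      simp only [Φ, h0, mul_zero]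
  refine ⟨⟨Φ, hΦ⟩, toLine_injective ?_⟩
  filter_upwards [toLine_inducedMap hH c ⟨Φ, hΦ⟩, hf] with s h1 h2
  rw [h1, h2]
  simp [Φ, diag]

theorem isInduced_repMinus (hH : ∀ g, g ∈ H ↔ coeffA g = 1)
    {c : ℝ} (hc : 0 < c)
    (hχ : ∀ h : H, χ h = Circle.exp (-(c * coeffB h))) : IsInduced H χ repMinus := by
  let _ : MeasurableSpace (Aff0 ⧸ H) := borel (Aff0 ⧸ H)
  have : BorelSpace (Aff0 ⧸ H) := ⟨rfl⟩
  have hclosed : IsClosed (H : Set Aff0) := by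
    have : (H : Set Aff0) = coeffA ⁻¹' {1} := Set.ext hH
    rw [this]
    exact isClosed_singleton.preimage continuous_coeffA
  have hcont : Continuous χ := by
    have : (χ : H → Circle) = fun h : H => Circle.exp (-(c * coeffB h)) := funext hχ
    rw [this]
    exact Circle.exp.continuous.comp
      (continuous_const.mul (continuous_coeffB.comp continuous_subtype_val)).neg
  let e : ℝ ≃ₜ Aff0 ⧸ H := quotientHomeomorph hH c
  refine ⟨hclosed, hcont, volume.map e, ?_, Measure.Regular.map e, fun g => ?_,
    inducedMap hH χ c, fun Φ => ?_, denseRange_inducedMap hH hχ,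
    fun g Φ Ψ h => inducedMap_equivariant hH hc hχ g Φ Ψ h⟩
  · rw [Ne, Measure.map_eq_zero_iff e.continuous.measurable.aemeasurable]
    exact NeZero.ne _
  · have hg := coeffA_pos g
    have hcomp : (fun z : Aff0 ⧸ H => g • z) ∘ e = e ∘ fun s => s - Real.log (coeffA g) := by
      funext s
      change ((g * diag c s : Aff0) : Aff0 ⧸ H) = diag c (s - Real.log (coeffA g))
      rw [mk_eq_mk_iff hH, coeffA_mul, diag, diag, coeffA_affMk, coeffA_affMk, ← sub_add,
        Real.exp_add, Real.exp_log hg, mul_comm]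
    rw [Measure.map_map (continuous_const_smul g).measurable e.continuous.measurable, hcomp,
      ← Measure.map_map e.continuous.measurable (by fun_prop), map_sub_right_eq_self]
  · rw [e.measurableEmbedding.lintegral_map, enorm_sq_eq_lintegral_toLine]
    refine lintegral_congr_ae ?_
    filter_upwards [toLine_inducedMap hH c Φ] with s hs
    rw [hs]
    exact congrArg (· ^ 2) (norm_section_out Φ (diag c s)).symm

theorem isOrbitMethodRep_repMinus : IsOrbitMethodRep OmegaMinus repMinus := by
  intro F hF
  rw [OmegaMinus_eq] at hF
  have hF : F genY < 0 := hF
  refine ⟨⟨lineY, isAdmissible_lineY hF⟩, fun 𝔥 h𝔥 => ?_⟩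
  have hmem := mem_iff_of_isAdmissible hF h𝔥
  have hH := mem_analyticSubgroup hmem
  let χ : analyticSubgroup 𝔥 →* Circle :=
    { toFun := fun h => Circle.exp (F genY * coeffB h)
      map_one' := by simp
      map_mul' := fun g h => by
        rw [Subgroup.coe_mul, coeffB_mul, (hH g).1 g.property, one_mul, mul_add, Circle.exp_add,
          mul_comm] }
  refine ⟨χ, fun V hV => ?_, isInduced_repMinus hH (neg_pos.2 hF) fun h => ?_⟩
  · change Circle.exp (F genY * coeffB (expG V)) = _
    rw [coeffB_expG_of_eq_zero V ((hmem V).1 hV), dual_apply F V, (hmem V).1 hV, zero_mul,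
      zero_add, mul_comm]
  · change Circle.exp (F genY * coeffB h) = _
    rw [neg_mul, neg_neg]

end AffPlane

open AffPlane
theorem theorem4p3 :
    -- the orbit is the open lower half-plane, and `(p, q)` are global coordinates on it
    (OmegaMinus = {F | F genY < 0} ∧ Set.BijOn chartMinus Set.univ OmegaMinus) ∧
    -- the group is exponential
    Function.Bijective expG ∧
    -- the operators `ℓ̂_Z` are well defined on test functions
    (∀ (Z : aff) (u : ℝ × ℝ → ℂ), IsTest u →
      (∀ x, Summable fun r => moyalTerm r (iHam Z) (fourierPInv u) x) ∧
      (∀ q, Integrable fun p => ell Z (fourierPInv u) (p, q)) ∧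
      IsTest (ellHat Z u)) ∧
    -- the representation
    ∃ T : UnitaryRep Aff0 HMinus,
      (∀ (g : Aff0) (f : HMinus), (T.act g f : ℝ → ℂ) =ᵐ[muMinus]
        fun y => Complex.exp (Complex.I * coeffB g * y) * (f : ℝ → ℂ) (coeffA g * y)) ∧
      T.IsIrreducible ∧
      IsOrbitMethodRep OmegaMinus T ∧
      ∀ (Z : aff) (V : HMinus ≃ₗᵢ[ℂ] HMinus),
        IsExpOf (ellHatGraph Z) V ↔ V = T.act (expG Z) := by
  refine ⟨⟨OmegaMinus_eq, bijOn_chartMinus⟩, expG_bijective, fun Z u hu => ⟨fun x =>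
    (hu.hasSum_moyalTerm Z x).summable, fun q => ?_, ?_⟩, repMinus, coeFn_repIsometry,
    repMinus_isIrreducible, isOrbitMethodRep_repMinus, isExpOf_ellHatGraph⟩
  · rw [hu.ell_fourierPInv]
    exact (hu.ellHatFormula Z).integrable_fourierPInv q
  · rw [hu.ellHat_eq]
    exact hu.ellHatFormula Z
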